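/- **Setting.** Let $n\ge 2$, let $\Omega\subset\mathbb R^n$ be a bounded domain and $E\subset\partial\Omega$ a set of tomography. A *broken ray* is a unit speed path $\gamma:[0,L]\to\bar\Omega$, $L>0$, consisting of finitely many line segments whose relative interiors lie in $\Omega$, with both endpoints in $\bar E$, and such that at each intermediate vertex $\gamma$ meets the reflecting part $\partial\Omega\setminus\bar E$ at a point near which $\partial\Omega$ is a $C^1$ hypersurface, and is reflected there so that the angle of incidence equals the angle of reflection. The broken ray transform of $f$ is $\gamma\mapsto\int_0^L f(\gamma(t))\,dt$. $C_{pw}(\bar\Omega,\mathbb R)$ consists of the bounded Borel functions $f:\bar\Omega\to\mathbb R$ for which there are finitely many disjoint open sets $U_i\subset\Omega$ with $\bar\Omega=\bigcup_i\bar U_i$ such that every $f|_{U_i}$ extends continuously to $\bar U_i$. The broken ray transform is called *injective* on $(\Omega,E)$ if any two $f_1,f_2\in C_{pw}(\bar\Omega,\mathbb R)$ with the same broken ray transform agree almost everywhere in $\Omega$ and at all points of $\bar\Omega$ where both are continuous, and any two $f_1,f_2\in C(\bar\Omega,\mathbb R)$ with the same broken ray transform agree on $\bar\Omega$. The *cone*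 with vertex $v$, axis direction $u\neq0$ and opening angle $\alpha\in(0,2\pi]$ is $\{x\ne v:\angle(x-v,u)<\alpha/2\}$ (in the plane, an open sector of angle $\alpha$). **Proposition.** The broken ray transform is injective on $(\Omega,E)$ in the following cases. 1. $\Omega\subset\mathbb R^2$ is a bounded domain contained in a cone with opening angle $\pi/m$, $m\in\{1,2,\dots\}$, and $E\subset\partial\Omega$ is any set such that $\partial\Omega\setminus E$ lies on the boundary of the cone. For example, in polar coordinates, $\Omega=\{(r,\theta):0<\theta<\pi/m,\ 0<r<h(\theta)\}$ with $E=\{(h(\theta),\theta):0<\theta<\pi/m\}$, where $h>0$ is a bounded continuous function on $(0,\pi/m)$. 2. The same as in (1) for every real $m\ge 1/2$, that is, for every opening angle in $(0,2\pi]$. 3. $\Omega=\{(x',x)\in\mathbb R^{n-1}\times\mathbb R:|x'|<kx,\ 0<|(x',x)|<h((x',x)/|(x',x)|)\}$ and $E=\{(x',x):|x'|<kx,\ |(x',x)|=h((x',x)/|(x',x)|)\}$, where $n\ge2$, $h:S^{n-1}\to(0,\infty)$ is continuous and $k\in(0,\infty)$ is such that $\pi/(2\arctan k)\in\mathbb N$.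 4. The same as in (3) for every $k\in\mathbb R$ without the restriction (for $k=0$ the set is empty and the claim is void). Moreover, the same holds with $\{|x'|<kx\}$ replaced by a cone in $\mathbb R^n$, $n\ge2$, with vertex $0$, any axis direction and any opening angle in $(0,2\pi]$; and, for a cone in $\mathbb R^n$ with any vertex, any axis direction and any opening angle in $(0,2\pi]$, it holds for every bounded domain $\Omega$ contained in the cone and every $E\subset\partial\Omega$ such that $\partial\Omega\setminus E$ lies on the boundary of the cone. In all these cases the broken ray transform is also injective on $(\Omega',E')$ for every subdomain $\Omega'\subset\Omega$, where $E'=\partial\Omega'\setminus(\partial\Omega\setminus E)$, i.e. the part of $\partial\Omega'$ in $\partial\Omega\setminus E$ stays outside of the set of tomography. -/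

import Mathlib

open MeasureTheory Set Filter Topology

noncomputable section

namespace BrokenRayTransform

/-- Euclidean space of dimension `n`. -/
abbrev Euc (n : ℕ) : Type := EuclideanSpace ℝ (Fin n)

/-- `S` is near `p` a `C¹` hypersurface (the regular zero set of a `C¹` function `ρ`) and `ν` is one
of its two unit normals at `p`. -/
def IsUnitNormal {n : ℕ} (S : Set (Euc n)) (p ν : Euc n) : Prop :=
  ‖ν‖ = 1 ∧ ∃ (ρ : Euc n → ℝ) (c : ℝ), ContDiffAt ℝ 1 ρ p ∧ c ≠ 0 ∧
    HasGradientAt ρ (c • ν) p ∧ ρ p = 0 ∧ ∀ᶠ y in 𝓝 p, (y ∈ S ↔ ρ y = 0)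

/-- `γ : [0, L] → closure Ω` is a broken ray in the domain `Ω` with set of tomography `E ⊆ ∂Ω`:
a unit speed path that starts and ends in `closure E`, is a straight segment in `Ω` on each of the
finitely many intervals `(t j, t (j+1))`, and at each of the intermediate times hits the reflecting
part `∂Ω \ closure E` of the boundary and is reflected there, the angle of incidence being equal to
the angle of reflection. -/
def IsBrokenRay {n : ℕ} (Ω E : Set (Euc n)) (L : ℝ) (γ : ℝ → Euc n) : Prop :=
  γ 0 ∈ closure E ∧ γ L ∈ closure E ∧
  ∃ (N : ℕ) (t : Fin (N + 2) → ℝ) (v : Fin (N + 1) → Euc n),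
    StrictMono t ∧ t 0 = 0 ∧ t (Fin.last (N + 1)) = L ∧
    (∀ j : Fin (N + 1), ‖v j‖ = 1 ∧
      (∀ s ∈ Icc (t j.castSucc) (t j.succ),
        γ s = γ (t j.castSucc) + (s - t j.castSucc) • v j) ∧
      (∀ s ∈ Ioo (t j.castSucc) (t j.succ), γ s ∈ Ω)) ∧
    (∀ i : Fin N, γ (t i.succ.castSucc) ∈ frontier Ω \ closure E ∧
      ∃ ν : Euc n, IsUnitNormal (frontier Ω) (γ (t i.succ.castSucc)) ν ∧
        v i.succ = v i.castSucc - (2 * inner ℝ (v i.castSucc) ν) • ν)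

/-- The integral of `f` over the unit speed path `γ : [0, L] → closure Ω`. -/
def brt {n : ℕ} (f : Euc n → ℝ) (L : ℝ) (γ : ℝ → Euc n) : ℝ :=
  ∫ s in (0 : ℝ)..L, f (γ s)

/-- Piecewise continuous functions on `closure Ω` (values of `f` elsewhere are irrelevant): there are
finitely many disjoint open pieces in `Ω` whose closures cover `closure Ω`, and from each piece `f`
extends continuously to the closure of the piece. On the interfaces between the pieces `f` may
have any values as long as it remains bounded and Borel, so that it can be integrated along every
path. -/
def PiecewiseContinuous {n : ℕ} (Ω : Set (Euc n)) (f : Euc n → ℝ) : Prop :=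
  (∃ (N : ℕ) (U : Fin N → Set (Euc n)),
    (∀ i, IsOpen (U i)) ∧ (∀ i, U i ⊆ Ω) ∧ Pairwise (fun i j => Disjoint (U i) (U j)) ∧
    closure Ω ⊆ ⋃ i, closure (U i) ∧
    ∀ i, ∃ g : Euc n → ℝ, ContinuousOn g (closure (U i)) ∧ EqOn f g (U i)) ∧
  Measurable ((closure Ω).domRestrict f) ∧ ∃ M : ℝ, ∀ x ∈ closure Ω, |f x| ≤ M

/-- Equality of the broken ray transforms of `f₁` and `f₂`. -/
def SameBrt {n : ℕ} (Ω E : Set (Euc n)) (f₁ f₂ : Euc n → ℝ) : Prop :=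
  ∀ (L : ℝ) (γ : ℝ → Euc n), IsBrokenRay Ω E L γ → brt f₁ L γ = brt f₂ L γ

/-- The broken ray transform is injective on piecewise continuous functions on `closure Ω`, and on
continuous ones. As usual, piecewise continuous functions are identified if they differ only on
interfaces between pieces: the conclusion is equality almost everywhere in `Ω` and at every point of
`closure Ω` at which both functions are continuous. For continuous functions it is equality at every
point of `closure Ω`. -/
def BrtInjective {n : ℕ} (Ω E : Set (Euc n)) : Prop :=
  (∀ f₁ f₂ : Euc n → ℝ, PiecewiseContinuous Ω f₁ → PiecewiseContinuous Ω f₂ →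
    SameBrt Ω E f₁ f₂ →
      f₁ =ᵐ[volume.restrict Ω] f₂ ∧
      ∀ x ∈ closure Ω, ContinuousWithinAt f₁ (closure Ω) x → ContinuousWithinAt f₂ (closure Ω) x →
        f₁ x = f₂ x) ∧
  (∀ f₁ f₂ : Euc n → ℝ, ContinuousOn f₁ (closure Ω) → ContinuousOn f₂ (closure Ω) →
    SameBrt Ω E f₁ f₂ → EqOn f₁ f₂ (closure Ω))

/-- Injectivity on `Ω`, and on every subdomain `Ω'` of `Ω`, where the part of `∂Ω'` on the reflecting
part of `∂Ω` remains reflecting and the rest of `∂Ω'` is the new set of tomography. -/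
def BrtInjectiveWithSubdomains {n : ℕ} (Ω E : Set (Euc n)) : Prop :=
  BrtInjective Ω E ∧
  ∀ Ω' : Set (Euc n), IsOpen Ω' → IsConnected Ω' → Ω' ⊆ Ω →
    BrtInjective Ω' (frontier Ω' \ (frontier Ω \ E))

/-- The open circular cone with vertex `v`, axis direction `u` and opening angle `α`
(in the plane: the open sector of angle `α` with bisector `u`). For `α = 2 * π` this is the
complement of a closed half-line. -/
def openCone {n : ℕ} (v u : Euc n) (α : ℝ) : Set (Euc n) :=
  {x | x ≠ v ∧ InnerProductGeometry.angle (x - v) u < α / 2}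

/-- `Ω` is a bounded domain in the cone with vertex `v`, axis direction `u` and opening angle `α`,
and the part of the boundary outside of the set of tomography `E` lies on the cone. -/
structure IsConicalDomain {n : ℕ} (v u : Euc n) (α : ℝ) (Ω E : Set (Euc n)) : Prop where
  isOpen : IsOpen Ω
  isConnected : IsConnected Ω
  isBounded : Bornology.IsBounded Ω
  subset_cone : Ω ⊆ openCone v u α
  subset_frontier : E ⊆ frontier Ω
  frontier_diff_subset : frontier Ω \ E ⊆ frontier (openCone v u α)

/-- The point of the plane with polar coordinates `(r, θ)`. -/
def polarPoint (r θ : ℝ) : Euc 2 := !₂[r * Real.cos θ, r * Real.sin θ]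

/-- The planar domain `0 < θ < α`, `0 < r < h θ`. -/
def polarDomain (α : ℝ) (h : ℝ → ℝ) : Set (Euc 2) :=
  {x | ∃ r θ : ℝ, 0 < θ ∧ θ < α ∧ 0 < r ∧ r < h θ ∧ x = polarPoint r θ}

/-- The curve `r = h θ`, `0 < θ < α`. -/
def polarGraph (α : ℝ) (h : ℝ → ℝ) : Set (Euc 2) :=
  {x | ∃ θ : ℝ, 0 < θ ∧ θ < α ∧ x = polarPoint (h θ) θ}

/-- A set of directions `{(x', x) ∈ ℝ^d × ℝ : |x'| < k x}`. -/
def slopeCone (d : ℕ) (k : ℝ) : Set (Euc (d + 1)) :=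
  {x | ‖(WithLp.toLp 2 (fun i : Fin d => x i.castSucc) : Euc d)‖ < k * x (Fin.last d)}

/-- The part `0 < |x| < h (x / |x|)` of a cone `C` with vertex `0`. -/
def radialDomain {n : ℕ} (C : Set (Euc n)) (h : Euc n → ℝ) : Set (Euc n) :=
  {x | x ∈ C ∧ 0 < ‖x‖ ∧ ‖x‖ < h (‖x‖⁻¹ • x)}

/-- The part `|x| = h (x / |x|)` of a cone `C` with vertex `0`. -/
def radialGraph {n : ℕ} (C : Set (Euc n)) (h : Euc n → ℝ) : Set (Euc n) :=
  {x | x ∈ C ∧ 0 < ‖x‖ ∧ ‖x‖ = h (‖x‖⁻¹ • x)}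

end BrokenRayTransform

end

open BrokenRayTransform

namespace BrokenRayTransform

/-! ### Injectivity of a line transform in polar coordinates -/

/-! Let `D` be the difference of the two functions, cut off to zero outside Ω. In a plane through
the axis of the cone, the cone is a sector of angle α. The normals of the cone along that plane lie
in the plane, so reflected paths stay in it. Unfolding the sector by repeated reflection turns `D`
into a function `F r θ` on a covering of the punctured plane. This function is `2α`-periodic in θ,
because the folding map is a triangle wave. A straight line at distance `p > 0` from the vertex, `r
= √(p² + t²)`, `θ = φ + arctan (t / p)`, sweeps an angle of only π, so it folds to a path with
finitely many kinks. The excursions of this path into Ω are broken rays up to finitely many times,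
so `D` integrates to zero along each of them (`IsReflectedPath.integral_eq_zero`,
`isReflectedPath_foldedLine`). Hence `F` integrates to zero over every such line. Nothing here
requires α to divide π, since the covering never has to close up to a plane.

The line transform is inverted in `ae_eq_zero_of_polar_line_integrals`. For each angular Fourier
coefficient `A k`, the hypothesis becomes a one-dimensional integral equation indexed by `p`.
Multiplying it by `p ^ N` and integrating over `p > 0` gives an integral over a half-plane. In polar
coordinates this factors as the moment of order `N + 1` of `A k` times the integral of `cos s ^ N`
against an exponential. For large `N` the second factor is nonzero, because `cos ^ N` concentrates
at `0`. So all high moments of the compactly supported `A k` vanish, and therefore `A k = 0` almost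
everywhere.

Fubini (`ae_eq_zero_of_planes`) passes from almost all planes through a line to the whole space. If
`α = 2π` and `n ≥ 3`, the boundary of the cone is a half-line of codimension at least two, and there
is no hypersurface to reflect from. In that case the planes contain a line perpendicular to the axis
and miss the half-line except at the vertex. Straight lines then suffice.

A broken ray may turn only where `frontier Ω` itself is a C¹ hypersurface. At a reflecting point it
is only given that the boundary of Ω is contained in that of the cone. A connectedness argument
shows that the two coincide locally (`isUnitNormal_frontier`). -/

theorem integrable_of_bounded_of_support {X F : Type*} [MeasurableSpace X] [NormedAddCommGroup F]
    {μ : Measure X} {f : X → F} (hf : AEStronglyMeasurable f μ) {M : ℝ} (hM : ∀ x, ‖f x‖ ≤ M)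
    {s : Set X} (hs : μ s ≠ ⊤) (h0 : ∀ x, x ∉ s → f x = 0) : Integrable f μ := by
  have h1 : IntegrableOn f s μ :=
    Measure.integrableOn_of_bounded hs hf (M := M) (Eventually.of_forall hM)
  refine (integrableOn_iff_integrable_of_support_subset ?_).1 h1
  intro x hx
  by_contra h
  exact hx (h0 x h)

/-- The power concentrates the mass at `0`, where `cos (l * s)` is close to `1`. Quantitatively, the
part `|s| ≤ δ / 2` contributes at least a multiple of `cos (δ / 2) ^ N`. This beats the possible
loss of order `cos δ ^ N` from `|s| > δ`. -/
theorem eventually_integral_cos_mul_cos_pow_pos (l : ℝ) :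
    ∀ᶠ N : ℕ in atTop,
      0 < ∫ s in (-(Real.pi / 2))..(Real.pi / 2), Real.cos (l * s) * Real.cos s ^ N := by
  have hpi := Real.pi_pos
  have hpi3 := Real.pi_gt_three
  obtain ⟨δ, hδ, hδ1, hδl⟩ : ∃ δ : ℝ, 0 < δ ∧ δ ≤ 1 ∧ |l| * δ ≤ 1 := by
    refine ⟨1 / (|l| + 1), by positivity, ?_, ?_⟩
    · rw [div_le_one (by positivity)]; linarith [abs_nonneg l]
    · rw [mul_one_div, div_le_one (by positivity)]; linarith
  have hc : ∀ x : ℝ, |x| ≤ 1 → (1 / 2 : ℝ) ≤ Real.cos x := by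
    intro x hx
    have := Real.one_sub_sq_div_two_le_cos (x := x)
    have h2 : x ^ 2 ≤ 1 := by rw [← sq_abs]; nlinarith [abs_nonneg x]
    linarith
  have hcl : ∀ s : ℝ, |s| ≤ δ → (1 / 2 : ℝ) ≤ Real.cos (l * s) := by
    intro s hs
    apply hc
    rw [abs_mul]
    exact (mul_le_mul_of_nonneg_left hs (abs_nonneg l)).trans hδl
  have hcδ : 0 < Real.cos δ := by linarith [hc δ (by rw [abs_of_pos hδ]; exact hδ1)]
  have hlt : Real.cos δ < Real.cos (δ / 2) :=
    Real.cos_lt_cos_of_nonneg_of_le_pi (by positivity) (by linarith) (by linarith)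
  have hcδ2 : 0 < Real.cos (δ / 2) := hcδ.trans hlt
  have hlim : Tendsto (fun N : ℕ => Real.pi * (Real.cos δ / Real.cos (δ / 2)) ^ N) atTop (𝓝 0) := by
    simpa using (tendsto_pow_atTop_nhds_zero_of_lt_one (by positivity)
      ((div_lt_one hcδ2).2 hlt)).const_mul Real.pi
  filter_upwards [hlim.eventually (gt_mem_nhds (show (0 : ℝ) < δ / 2 by positivity))] with N hN
  have hN' : Real.pi * Real.cos δ ^ N < δ / 2 * Real.cos (δ / 2) ^ N := by
    rw [div_pow, ← mul_div_assoc, div_lt_iff₀ (by positivity)] at hN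
    exact hN
  -- Adding the constant `cos δ ^ N` makes the integrand nonnegative on the whole interval, so the
  -- integral may be restricted to `|s| ≤ δ / 2`. The price is `π * cos δ ^ N`.
  have hcont : Continuous fun s : ℝ => Real.cos (l * s) * Real.cos s ^ N + Real.cos δ ^ N := by
    fun_prop
  have habs : ∀ s : ℝ, |s| ≤ Real.pi / 2 → δ < |s| → Real.cos s ≤ Real.cos δ := by
    intro s hs hs2
    rw [← Real.cos_abs s]
    exact Real.cos_le_cos_of_nonneg_of_le_pi hδ.le (by linarith) hs2.le
  have hnn : ∀ s : ℝ, |s| ≤ Real.pi / 2 →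
      0 ≤ Real.cos (l * s) * Real.cos s ^ N + Real.cos δ ^ N := by
    intro s hs
    have hs0 : 0 ≤ Real.cos s := Real.cos_nonneg_of_mem_Icc ⟨by linarith [neg_abs_le s], by
      linarith [le_abs_self s]⟩
    by_cases h : |s| ≤ δ
    · have := hcl s h
      positivity
    · have h1 : Real.cos s ^ N ≤ Real.cos δ ^ N :=
        pow_le_pow_left₀ hs0 (habs s hs (not_le.1 h)) N
      have h2 := Real.neg_one_le_cos (l * s)
      have h3 : 0 ≤ Real.cos s ^ N := by positivity
      nlinarith
  have h1 : ∫ s in (-(δ / 2))..(δ / 2), (Real.cos (l * s) * Real.cos s ^ N + Real.cos δ ^ N) ≤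
      ∫ s in (-(Real.pi / 2))..(Real.pi / 2),
        (Real.cos (l * s) * Real.cos s ^ N + Real.cos δ ^ N) := by
    refine intervalIntegral.integral_mono_interval (by linarith) (by linarith) (by linarith) ?_
      (hcont.intervalIntegrable _ _)
    refine (ae_restrict_iff' measurableSet_Ioc).2 (Eventually.of_forall fun s hs => ?_)
    exact hnn s (abs_le.2 ⟨hs.1.le, hs.2⟩)
  have h2 : ∫ s in (-(δ / 2))..(δ / 2), (1 / 2 * Real.cos (δ / 2) ^ N) ≤
      ∫ s in (-(δ / 2))..(δ / 2), (Real.cos (l * s) * Real.cos s ^ N + Real.cos δ ^ N) := by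
    refine intervalIntegral.integral_mono_on (by linarith) (by simp)
      (hcont.intervalIntegrable _ _) fun s hs => ?_
    have hs' : |s| ≤ δ / 2 := abs_le.2 hs
    have h3 : Real.cos (δ / 2) ≤ Real.cos s := by
      rw [← Real.cos_abs s]
      exact Real.cos_le_cos_of_nonneg_of_le_pi (abs_nonneg s) (by linarith) hs'
    have h4 := hcl s (by linarith)
    have h5 : Real.cos (δ / 2) ^ N ≤ Real.cos s ^ N := pow_le_pow_left₀ hcδ2.le h3 N
    have h6 : 0 < Real.cos (δ / 2) ^ N := by positivity
    have h7 : 0 < Real.cos δ ^ N := by positivity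
    nlinarith
  rw [intervalIntegral.integral_const] at h2
  have h3 : ∫ s in (-(Real.pi / 2))..(Real.pi / 2),
        (Real.cos (l * s) * Real.cos s ^ N + Real.cos δ ^ N) =
      (∫ s in (-(Real.pi / 2))..(Real.pi / 2), Real.cos (l * s) * Real.cos s ^ N) +
        (Real.pi / 2 - -(Real.pi / 2)) * Real.cos δ ^ N := by
    rw [intervalIntegral.integral_add (by
      apply Continuous.intervalIntegrable; fun_prop) (by simp), intervalIntegral.integral_const,
      smul_eq_mul]
  simp only [smul_eq_mul] at h2
  have e1 : (δ / 2 - -(δ / 2)) * (1 / 2 * Real.cos (δ / 2) ^ N) = δ / 2 * Real.cos (δ / 2) ^ N := by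
    ring
  have e2 : (Real.pi / 2 - -(Real.pi / 2)) * Real.cos δ ^ N = Real.pi * Real.cos δ ^ N := by ring
  rw [e1] at h2
  rw [h3, e2] at h1
  linarith

/-- A bounded function with bounded support on the half-line vanishes almost everywhere if all of
its moments of large order vanish. -/
theorem ae_eq_zero_of_moments {f : ℝ → ℂ} (hf : Measurable f) {M R : ℝ} (hR : 0 < R)
    (hM : ∀ r, ‖f r‖ ≤ M) (h0 : ∀ r, R < r → f r = 0)
    (hmom : ∀ᶠ N : ℕ in atTop, ∫ r in Ioi (0 : ℝ), (r : ℂ) ^ N * f r = 0) :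
    ∀ᵐ r ∂volume.restrict (Ioi (0 : ℝ)), f r = 0 := by
  obtain ⟨K, hK⟩ := eventually_atTop.1 hmom
  -- Absorbing `r ^ K` makes every moment of `g` vanish, including those of low order. The factor is
  -- nonzero for `r > 0`, so it costs nothing at the end.
  let g : ℝ → ℂ := (Ioi (0 : ℝ)).indicator fun r => (r : ℂ) ^ K * f r
  have hgm : Measurable g := by
    refine Measurable.indicator ?_ measurableSet_Ioi
    fun_prop
  have hM0 : 0 ≤ M := (norm_nonneg _).trans (hM 0)
  have hg0 : ∀ r, r ∉ Icc 0 R → g r = 0 := by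
    intro r hr
    by_cases h : 0 < r
    · have : R < r := by
        by_contra h'
        exact hr ⟨h.le, not_lt.1 h'⟩
      simp [g, h0 r this]
    · simp [g, h]
  have hgb : ∀ r, ‖g r‖ ≤ R ^ K * M := by
    intro r
    by_cases h : r ∈ Icc 0 R
    · by_cases hr : 0 < r
      · simp only [g, indicator, mem_Ioi, hr, if_true, norm_mul, norm_pow, Complex.norm_real]
        gcongr
        · rw [Real.norm_of_nonneg h.1]; exact h.2
        · exact hM r
      · simp only [g, indicator, mem_Ioi, hr, if_false, norm_zero]
        positivity
    · rw [hg0 r h, norm_zero]; positivity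
  have hgi : Integrable g := integrable_of_bounded_of_support hgm.aestronglyMeasurable hgb
    (s := Icc 0 R) (by simp) hg0
  have hpoly : ∀ P : Polynomial ℝ, ∫ r, (P.eval r) • g r = 0 := by
    intro P
    have hi : ∀ n : ℕ, Integrable fun r : ℝ => (r ^ n) • g r := by
      intro n
      refine integrable_of_bounded_of_support (M := R ^ n * (R ^ K * M)) (s := Icc 0 R)
        (by fun_prop) ?_ (by simp) ?_
      · intro r
        by_cases h : r ∈ Icc 0 R
        · rw [norm_smul, norm_pow, Real.norm_of_nonneg h.1]
          have := hgb r
          have := h.1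
          have := h.2
          gcongr
        · rw [hg0 r h, smul_zero, norm_zero]; positivity
      · intro r hr; rw [hg0 r hr, smul_zero]
    have hz : ∀ n : ℕ, ∫ r, (r ^ n) • g r = 0 := by
      intro n
      have := hK (K + n) (by omega)
      rw [← integral_indicator measurableSet_Ioi] at this
      rw [← this]
      congr 1
      ext r
      by_cases h : 0 < r
      · simp [g, h]; ring
      · simp [g, h]
    have : ∀ r : ℝ, (P.eval r) • g r = ∑ n ∈ Finset.range (P.natDegree + 1),
        P.coeff n • ((r ^ n) • g r) := by
      intro r
      rw [Polynomial.eval_eq_sum_range, Finset.sum_smul]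
      simp [mul_assoc]
    simp_rw [this]
    refine (integral_finsetSum _ (f := fun (n : ℕ) (r : ℝ) => P.coeff n • (r ^ n • g r))
      fun n _ => (hi n).smul (P.coeff n)).trans ?_
    refine Finset.sum_eq_zero fun n _ => ?_
    rw [integral_smul, hz, smul_zero]
  -- Weierstrass approximation on `[0, R]`, outside which `g` is zero, replaces a test function by a
  -- polynomial.
  have hg : ∀ᵐ r, g r = 0 := by
    refine ae_eq_zero_of_integral_contDiff_smul_eq_zero hgi.locallyIntegrable fun φ hφ _ => ?_
    have hφc := hφ.continuous
    rw [← norm_le_zero_iff]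
    refine le_of_forall_pos_le_add fun ε hε => ?_
    obtain ⟨P, hP⟩ := exists_polynomial_near_of_continuousOn 0 R φ hφc.continuousOn
      (ε / ((∫ r, ‖g r‖) + 1)) (by positivity)
    have hb : ∀ r, ‖φ r • g r - P.eval r • g r‖ ≤ ε / ((∫ r, ‖g r‖) + 1) * ‖g r‖ := by
      intro r
      by_cases h : r ∈ Icc 0 R
      · rw [← sub_smul, norm_smul, Real.norm_eq_abs, abs_sub_comm]
        gcongr
        exact (hP r h).le
      · simp [hg0 r h]
    have hint : ∀ ψ : ℝ → ℝ, Continuous ψ → Integrable fun r => ψ r • g r := by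
      intro ψ hψ
      obtain ⟨C, hC⟩ := (isCompact_Icc (a := 0) (b := R)).exists_bound_of_continuousOn
        hψ.continuousOn
      refine integrable_of_bounded_of_support (M := |C| * (R ^ K * M)) (s := Icc 0 R)
        (by fun_prop) ?_ (by simp) ?_
      · intro r
        by_cases h : r ∈ Icc 0 R
        · rw [norm_smul]
          exact mul_le_mul ((hC r h).trans (le_abs_self C)) (hgb r) (norm_nonneg _) (abs_nonneg _)
        · rw [hg0 r h, smul_zero, norm_zero]; positivity
      · intro r hr; rw [hg0 r hr, smul_zero]
    have e : ∫ r, φ r • g r = ∫ r, (φ r • g r - P.eval r • g r) := by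
      rw [integral_sub (hint φ hφc) (hint _ P.continuous), hpoly, sub_zero]
    rw [e, zero_add]
    calc ‖∫ r, (φ r • g r - P.eval r • g r)‖ ≤ ∫ r, ε / ((∫ r, ‖g r‖) + 1) * ‖g r‖ :=
          norm_integral_le_of_norm_le (hgi.norm.const_mul _) (Eventually.of_forall hb)
      _ = ε * ((∫ r, ‖g r‖) / ((∫ r, ‖g r‖) + 1)) := by rw [integral_const_mul]; ring
      _ ≤ ε := by
        have : 0 ≤ ∫ r, ‖g r‖ := integral_nonneg fun r => norm_nonneg _
        refine mul_le_of_le_one_right hε.le ?_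
        rw [div_le_one (by positivity)]; linarith
  rw [ae_restrict_iff' measurableSet_Ioi]
  filter_upwards [hg] with r hr h
  have h' : (0 : ℝ) < r := h
  simpa [g, h', h'.ne'] using hr

/-- Completeness of the exponentials in L² of the circle of length `T`, applied to `f` carried over
from one period. -/
theorem ae_eq_zero_of_fourier_integrals {T : ℝ} (hT : 0 < T) {f : ℝ → ℂ} (hf : Measurable f)
    {M : ℝ} (hM : ∀ x, ‖f x‖ ≤ M) (a : ℝ)
    (h0 : ∀ k : ℤ, ∫ x in a..a + T, Complex.exp (2 * Real.pi * Complex.I * k * x / T) * f x = 0) :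
    ∀ᵐ x ∂volume.restrict (Ioc a (a + T)), f x = 0 := by
  have : Fact (0 < T) := ⟨hT⟩
  let F : AddCircle T → ℂ := fun y => f (AddCircle.measurableEquivIoc T a y)
  have hFm : Measurable F :=
    hf.comp (measurable_subtype_coe.comp (AddCircle.measurableEquivIoc T a).measurable)
  have hF : ∀ x ∈ Ioc a (a + T), F (x : AddCircle T) = f x := by
    intro x hx
    exact congrArg f (AddCircle.liftIoc_coe_apply (f := fun z : ℝ => z) hx)
  have hL : MemLp F 2 (AddCircle.haarAddCircle (T := T)) :=
    MemLp.of_bound hFm.aestronglyMeasurable M (Eventually.of_forall fun y => hM _)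
  have hc : ∀ k, fourierCoeff F k = 0 := by
    intro k
    rw [fourierCoeff_eq_intervalIntegral F k a]
    have : ∫ x in a..a + T, (fourier (-k)) (x : AddCircle T) • F x =
        ∫ x in a..a + T, Complex.exp (2 * Real.pi * Complex.I * (-k : ℤ) * x / T) * f x := by
      refine intervalIntegral.integral_congr_ae (Eventually.of_forall fun x hx => ?_)
      rw [uIoc_of_le (by linarith)] at hx
      rw [fourier_coe_apply, hF x hx, smul_eq_mul]
    rw [this, h0, smul_zero]
  have hz : hL.toLp F = 0 := by
    apply fourierBasis.repr.injective
    ext k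
    rw [fourierBasis_repr, map_zero]
    change _ = (0 : ℂ)
    rw [← hc k]
    unfold fourierCoeff
    refine integral_congr_ae ?_
    filter_upwards [hL.coeFn_toLp] with y hy
    rw [hy]
  have hae : F =ᵐ[AddCircle.haarAddCircle] 0 := by
    have := hL.coeFn_toLp
    rw [hz] at this
    exact this.symm.trans (Lp.coeFn_zero _ _ _)
  have hvol : ∀ᵐ y ∂(volume : Measure (AddCircle T)), F y = 0 := by
    rw [AddCircle.volume_eq_smul_haarAddCircle]
    exact Measure.ae_smul_measure hae _
  have h1 := (AddCircle.measurePreserving_mk T a).quasiMeasurePreserving.ae hvol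
  filter_upwards [h1, ae_restrict_mem measurableSet_Ioc] with x hx hxm
  rw [← hF x hxm]
  exact hx

/-- In polar coordinates `arctan (x.2 / x.1)` is the angle itself, so the integrand separates. The
extra power of `r` is the Jacobian. -/
theorem integral_right_half_plane_polar {N : ℕ} {A : ℝ → ℂ} {e : ℝ → ℂ} :
    ∫ x : ℝ × ℝ, {x : ℝ × ℝ | 0 < x.1}.indicator (fun x =>
      (x.1 : ℂ) ^ N * (e (Real.arctan (x.2 / x.1)) * A (√(x.1 ^ 2 + x.2 ^ 2)))) x =
    (∫ r in Ioi (0 : ℝ), (r : ℂ) ^ (N + 1) * A r) *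
      ∫ s in (-(Real.pi / 2))..(Real.pi / 2), (Real.cos s : ℂ) ^ N * e s := by
  have hpi := Real.pi_pos
  rw [← integral_comp_polarCoord_symm, intervalIntegral.integral_of_le (by linarith),
    integral_Ioc_eq_integral_Ioo]
  have hsub : Ioo (-(Real.pi / 2)) (Real.pi / 2) ⊆ Ioo (-Real.pi) Real.pi :=
    Ioo_subset_Ioo (by linarith) (by linarith)
  have hs : ∫ s in Ioo (-(Real.pi / 2)) (Real.pi / 2), (Real.cos s : ℂ) ^ N * e s =
      ∫ s in Ioo (-Real.pi) Real.pi, (Ioo (-(Real.pi / 2)) (Real.pi / 2)).indicator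
        (fun s => (Real.cos s : ℂ) ^ N * e s) s := by
    rw [setIntegral_indicator measurableSet_Ioo, inter_eq_self_of_subset_right hsub]
  rw [hs, ← integral_prod_mul, polarCoord_target, Measure.prod_restrict, ← Measure.volume_eq_prod]
  refine setIntegral_congr_fun (measurableSet_Ioi.prod measurableSet_Ioo) ?_
  rintro ⟨r, s⟩ ⟨hr, hs⟩
  simp only [mem_Ioi, mem_Ioo] at hr hs
  simp only [polarCoord_symm_apply, indicator, mem_ofPred_eq, mem_Ioo]
  by_cases h : -(Real.pi / 2) < s ∧ s < Real.pi / 2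
  · have hc : 0 < Real.cos s := Real.cos_pos_of_mem_Ioo h
    have h1 : 0 < r * Real.cos s := mul_pos hr hc
    have h2 : r * Real.sin s / (r * Real.cos s) = Real.tan s := by
      rw [mul_div_mul_left _ _ hr.ne', Real.tan_eq_sin_div_cos]
    have h3 : (r * Real.cos s) ^ 2 + (r * Real.sin s) ^ 2 = r ^ 2 := by
      have := Real.sin_sq_add_cos_sq s
      linear_combination r ^ 2 * this
    rw [if_pos h1, if_pos h, h2, Real.arctan_tan h.1 h.2, h3, Real.sqrt_sq hr.le]
    simp only [Complex.real_smul]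
    push_cast
    ring
  · have hc : ¬ 0 < r * Real.cos s := by
      rw [mul_pos_iff_of_pos_left hr, not_lt]
      rcases not_and_or.1 h with h | h
      · rw [← Real.cos_neg]
        exact Real.cos_nonpos_of_pi_div_two_le_of_le (by linarith) (by linarith)
      · exact Real.cos_nonpos_of_pi_div_two_le_of_le (by linarith) (by linarith)
    rw [if_neg hc, if_neg h]
    simp

/-- A bounded function of polar coordinates on a covering of the punctured plane, periodic in the
angle and of bounded support, vanishes if its integrals over all straight lines vanish. -/
theorem ae_eq_zero_of_polar_line_integrals {T : ℝ} (hT : 0 < T) {F : ℝ → ℝ → ℝ}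
    (hF : Measurable (Function.uncurry F)) {M R : ℝ} (hR : 0 < R) (hM : ∀ r θ, |F r θ| ≤ M)
    (h0 : ∀ r θ, R < r → F r θ = 0) (hper : ∀ r, Function.Periodic (F r) T)
    (hline : ∀ p φ : ℝ, 0 < p → ∫ t, F (√(p ^ 2 + t ^ 2)) (φ + Real.arctan (t / p)) = 0) (a : ℝ) :
    ∀ᵐ r ∂volume.restrict (Ioi (0 : ℝ)), ∀ᵐ θ ∂volume.restrict (Ioc a (a + T)), F r θ = 0 := by
  have hM0 : 0 ≤ M := (abs_nonneg _).trans (hM 0 0)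
  let e : ℤ → ℝ → ℂ := fun k θ => Complex.exp (2 * Real.pi * Complex.I * k * θ / T)
  have he1 : ∀ k θ, ‖e k θ‖ = 1 := by
    intro k θ
    have : 2 * Real.pi * Complex.I * k * θ / T = ((2 * Real.pi * k * θ / T : ℝ) : ℂ) * Complex.I := by
      push_cast; ring
    simp only [e, this, Complex.norm_exp_ofReal_mul_I]
  have hec : ∀ k, Continuous (e k) := by intro k; fun_prop
  have hadd : ∀ k x y, e k (x + y) = e k x * e k y := by
    intro k x y
    simp only [e, ← Complex.exp_add]
    congr 1; push_cast; ring
  have heT : ∀ k, Function.Periodic (e k) T := by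
    intro k x
    rw [hadd]
    have : e k T = 1 := by
      have hT' : (T : ℂ) ≠ 0 := by exact_mod_cast hT.ne'
      simp only [e]
      rw [mul_div_assoc, div_self hT', mul_one, Complex.exp_eq_one_iff]
      exact ⟨k, by ring⟩
    rw [this, mul_one]
  let A : ℤ → ℝ → ℂ := fun k r => ∫ θ in Ioc a (a + T), e k θ * F r θ
  have hAm : ∀ k, Measurable (A k) := by
    intro k
    have : StronglyMeasurable (Function.uncurry fun (r θ : ℝ) => e k θ * (F r θ : ℂ)) := by
      refine Measurable.stronglyMeasurable ?_
      have h1 : Measurable fun x : ℝ × ℝ => e k x.2 := (hec k).measurable.comp measurable_snd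
      exact h1.mul (Complex.measurable_ofReal.comp hF)
    exact this.integral_prod_right.measurable
  have hAb : ∀ k r, ‖A k r‖ ≤ M * T := by
    intro k r
    have := norm_setIntegral_le_of_norm_le_const (μ := volume) (s := Ioc a (a + T))
      (f := fun θ => e k θ * (F r θ : ℂ)) (C := M) (by simp) (fun θ _ => by
        rw [norm_mul, he1, one_mul, Complex.norm_real]; exact hM r θ)
    simpa [A, hT.le] using this
  have hA0 : ∀ k r, R < r → A k r = 0 := by
    intro k r hr
    simp [A, h0 r _ hr]
  -- Translating the angle multiplies a Fourier coefficient by a character. Periodicity restores the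
  -- interval of integration.
  have hshift : ∀ k r s, ∫ φ in Ioc a (a + T), e k φ * F r (φ + s) = e k (-s) * A k r := by
    intro k r s
    have h1 : ∀ φ, e k φ * F r (φ + s) = e k (-s) * (e k (φ + s) * F r (φ + s)) := by
      intro φ
      rw [← mul_assoc, ← hadd]
      congr 2; ring
    simp_rw [h1]
    rw [integral_const_mul]
    congr 1
    simp only [A]
    rw [← intervalIntegral.integral_of_le (by linarith),
      ← intervalIntegral.integral_of_le (by linarith),
      intervalIntegral.integral_comp_add_right (fun x => e k x * F r x), add_right_comm]
    refine Function.Periodic.intervalIntegral_add_eq ?_ _ _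
    intro x
    change e k (x + T) * (F r (x + T) : ℂ) = _
    rw [heT, hper]
  have hsqrt : ∀ p t : ℝ, R < |t| → R < √(p ^ 2 + t ^ 2) := by
    intro p t ht
    refine ht.trans_le ?_
    rw [← Real.sqrt_sq_eq_abs]
    exact Real.sqrt_le_sqrt (by nlinarith [sq_nonneg p])
  -- Fourier transform of the line condition in the direction φ of the line: each frequency
  -- satisfies its own equation in `p`.
  have hcol : ∀ k p, 0 < p →
      ∫ t, e k (-Real.arctan (t / p)) * A k (√(p ^ 2 + t ^ 2)) = 0 := by
    intro k p hp
    simp_rw [← hshift]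
    rw [integral_integral_swap]
    · have : ∀ φ, ∫ t, e k φ * (F (√(p ^ 2 + t ^ 2)) (φ + Real.arctan (t / p)) : ℂ) = 0 := by
        intro φ
        rw [integral_const_mul, integral_complex_ofReal, hline p φ hp]
        simp
      simp [this]
    · refine integrable_of_bounded_of_support (M := M) (s := Icc (-R) R ×ˢ univ) ?_ ?_ ?_ ?_
      · refine Measurable.aestronglyMeasurable ?_
        have h1 : Measurable fun x : ℝ × ℝ => e k x.2 := (hec k).measurable.comp measurable_snd
        have h2 : Measurable fun x : ℝ × ℝ =>
            ((√(p ^ 2 + x.1 ^ 2), x.2 + Real.arctan (x.1 / p)) : ℝ × ℝ) := by fun_prop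
        exact h1.mul (Complex.measurable_ofReal.comp (hF.comp h2))
      · rintro ⟨t, φ⟩
        simp only [Function.uncurry]
        rw [norm_mul, he1, one_mul, Complex.norm_real]; exact hM _ _
      · rw [Measure.prod_prod]
        simp [ENNReal.mul_eq_top]
      · rintro ⟨t, φ⟩ h
        have ht : R < |t| := by
          by_contra h'
          exact h ⟨abs_le.1 (not_lt.1 h'), mem_univ _⟩
        simp only [Function.uncurry]
        rw [h0 _ _ (hsqrt p t ht)]
        simp
  -- Multiply the previous equation by `p ^ N`, integrate over `p > 0` and change to polar
  -- coordinates.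
  have hG : ∀ (k : ℤ) (N : ℕ), (∫ r in Ioi (0 : ℝ), (r : ℂ) ^ (N + 1) * A k r) *
      ∫ s in (-(Real.pi / 2))..(Real.pi / 2), (Real.cos s : ℂ) ^ N * e k (-s) = 0 := by
    intro k N
    rw [← integral_right_half_plane_polar (e := fun s => e k (-s)), Measure.volume_eq_prod,
      integral_prod]
    · have : ∀ p : ℝ, ∫ t : ℝ, {x : ℝ × ℝ | 0 < x.1}.indicator (fun x => (x.1 : ℂ) ^ N *
          (e k (-Real.arctan (x.2 / x.1)) * A k (√(x.1 ^ 2 + x.2 ^ 2)))) (p, t) = 0 := by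
        intro p
        by_cases hp : 0 < p
        · simp only [indicator, mem_ofPred_eq, hp, if_true]
          rw [integral_const_mul, hcol k p hp, mul_zero]
        · simp [indicator, hp]
      simp [this]
    · refine integrable_of_bounded_of_support (M := R ^ N * (M * T))
        (s := Icc 0 R ×ˢ Icc (-R) R) ?_ ?_ ?_ ?_
      · refine Measurable.aestronglyMeasurable ?_
        refine Measurable.indicator ?_ (measurableSet_lt measurable_const measurable_fst)
        have h1 : Measurable fun x : ℝ × ℝ => e k (-Real.arctan (x.2 / x.1)) :=
          (hec k).measurable.comp (by fun_prop)
        have h2 : Measurable fun x : ℝ × ℝ => A k (√(x.1 ^ 2 + x.2 ^ 2)) :=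
          (hAm k).comp (by fun_prop)
        have h3 : Measurable fun x : ℝ × ℝ => (x.1 : ℂ) ^ N := by fun_prop
        exact h3.mul (h1.mul h2)
      · rintro ⟨p, t⟩
        by_cases hp : 0 < p
        · simp only [indicator, mem_ofPred_eq, hp, if_true]
          rw [norm_mul, norm_mul, he1, one_mul, norm_pow, Complex.norm_real,
            Real.norm_of_nonneg hp.le]
          by_cases hpR : p ≤ R
          · have := hAb k (√(p ^ 2 + t ^ 2))
            gcongr
          · have : R < √(p ^ 2 + t ^ 2) := by
              rw [add_comm]
              exact hsqrt t p ((not_le.1 hpR).trans_le (le_abs_self p))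
            rw [hA0 k _ this, norm_zero, mul_zero]
            positivity
        · simp only [indicator, mem_ofPred_eq, hp, if_false, norm_zero]
          positivity
      · rw [Measure.prod_prod]
        simp [ENNReal.mul_eq_top]
      · rintro ⟨p, t⟩ h
        by_cases hp : 0 < p
        · simp only [indicator, mem_ofPred_eq, hp, if_true]
          have : R < √(p ^ 2 + t ^ 2) := by
            by_cases ht : R < |t|
            · exact hsqrt p t ht
            · rw [add_comm]
              refine hsqrt t p (lt_of_lt_of_le ?_ (le_abs_self p))
              by_contra h'
              exact h ⟨⟨hp.le, not_lt.1 h'⟩, abs_le.1 (not_lt.1 ht)⟩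
          rw [hA0 k _ this, mul_zero, mul_zero]
        · simp [indicator, hp]
  have hAz : ∀ k, ∀ᵐ r ∂volume.restrict (Ioi (0 : ℝ)), A k r = 0 := by
    intro k
    refine ae_eq_zero_of_moments (hAm k) hR (hAb k) (hA0 k) ?_
    obtain ⟨K, hK⟩ := eventually_atTop.1
      (eventually_integral_cos_mul_cos_pow_pos (2 * Real.pi * k / T))
    refine eventually_atTop.2 ⟨K + 1, fun N hN => ?_⟩
    obtain ⟨N, rfl⟩ : ∃ N', N = N' + 1 := ⟨N - 1, by omega⟩
    refine (mul_eq_zero.1 (hG k N)).resolve_right fun hz => ?_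
    have hpos := hK N (by omega)
    -- The real part of the exponential integral is the cosine integral with `l = 2πk / T`, which is
    -- positive.
    have hre := congrArg Complex.re hz
    have hint : IntervalIntegrable (fun s : ℝ => (Real.cos s : ℂ) ^ N * e k (-s)) volume
        (-(Real.pi / 2)) (Real.pi / 2) := by
      apply Continuous.intervalIntegrable
      have := hec k
      fun_prop
    have h3 := (Complex.reCLM).intervalIntegral_comp_comm hint
    simp only [Complex.reCLM_apply] at h3
    rw [← h3, Complex.zero_re] at hre
    rw [← hre] at hpos
    refine hpos.ne ?_
    refine intervalIntegral.integral_congr fun s _ => ?_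
    have h4 : e k (-s) = Complex.exp (((-(2 * Real.pi * k / T * s) : ℝ) : ℂ) * Complex.I) := by
      simp only [e]; congr 1; push_cast; ring
    have h5 : ((Real.cos s : ℂ) ^ N) = ((Real.cos s ^ N : ℝ) : ℂ) := by push_cast; rfl
    rw [h4, h5, Complex.re_ofReal_mul, Complex.exp_ofReal_mul_I_re, Real.cos_neg, mul_comm]
  filter_upwards [ae_all_iff.2 hAz] with r hr
  have hFr : Measurable fun θ => (F r θ : ℂ) :=
    Complex.measurable_ofReal.comp (hF.comp (measurable_const.prodMk measurable_id))
  have := ae_eq_zero_of_fourier_integrals hT hFr (M := M)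
    (fun θ => by rw [Complex.norm_real]; exact hM r θ) a (fun k => by
      rw [intervalIntegral.integral_of_le (by linarith)]; exact hr k)
  filter_upwards [this] with θ hθ
  exact_mod_cast hθ

/-! ### Integrals over infinite reflected paths -/

/-- A unit speed path on the whole real line, with finitely many kinks at the times in `B`, such that
all of its excursions into `Ω` are broken rays. -/
structure IsReflectedPath {n : ℕ} (Ω E : Set (Euc n)) (σ : ℝ → Euc n) (B : Set ℝ) : Prop where
  continuous : Continuous σ
  finite : B.Finite
  segment : ∀ x y, x < y → (∀ t ∈ Ioo x y, t ∉ B) →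
    ∃ V : Euc n, ‖V‖ = 1 ∧ ∀ s ∈ Icc x y, σ s = σ x + (s - x) • V
  notMem : ∀ t ∈ B, σ t ∉ Ω
  tomography : ∀ t, t ∉ B → σ t ∈ frontier Ω → σ t ∈ closure E
  inside : ∀ t ∈ B, σ t ∈ frontier Ω → σ t ∉ closure E →
    (∃ᶠ s in 𝓝[≠] t, σ s ∈ Ω) → ∀ᶠ s in 𝓝[≠] t, σ s ∈ Ω
  reflect : ∀ t ∈ B, σ t ∈ frontier Ω → σ t ∉ closure E →
    ∃ ν V W : Euc n, IsUnitNormal (frontier Ω) (σ t) ν ∧ W = V - (2 * inner ℝ V ν) • ν ∧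
      (∀ᶠ s in 𝓝[<] t, σ s = σ t + (s - t) • V) ∧ (∀ᶠ s in 𝓝[>] t, σ s = σ t + (s - t) • W)
  bounded : ∃ R, ∀ t, σ t ∈ Ω → |t| ≤ R

/-- The vertices are `a`, `b` and the kinks strictly between them, listed in increasing order.
Between consecutive ones the path is straight and lies in Ω, because `hin` allows other positions
only at kinks. -/
theorem IsReflectedPath.isBrokenRay {n : ℕ} {Ω E : Set (Euc n)} {σ : ℝ → Euc n} {B : Set ℝ}
    (h : IsReflectedPath Ω E σ B) {a b : ℝ} (hab : a < b)
    (hin : ∀ t ∈ Ioo a b, σ t ∈ Ω ∨ (t ∈ B ∧ σ t ∈ frontier Ω \ closure E))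
    (ha : σ a ∈ closure E) (hb : σ b ∈ closure E) :
    IsBrokenRay Ω E (b - a) fun s => σ (a + s) := by
  classical
  let S₀ : Finset ℝ := h.finite.toFinset.filter (· ∈ Ioo a b)
  let S : Finset ℝ := insert a (insert b S₀)
  have hS₀ : ∀ x, x ∈ S₀ ↔ x ∈ B ∧ x ∈ Ioo a b := by intro x; simp [S₀]
  have hS : ∀ x, x ∈ S ↔ x = a ∨ x = b ∨ (x ∈ B ∧ x ∈ Ioo a b) := by
    intro x; simp only [S, Finset.mem_insert, hS₀]
  have hcard : S.card = S₀.card + 2 := by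
    have hb' : b ∉ S₀ := by rw [hS₀]; rintro ⟨-, h⟩; exact lt_irrefl _ h.2
    have ha' : a ∉ insert b S₀ := by
      rw [Finset.mem_insert, hS₀]; rintro (h | ⟨-, h⟩)
      · exact hab.ne h
      · exact lt_irrefl _ h.1
    rw [Finset.card_insert_of_notMem ha', Finset.card_insert_of_notMem hb']
  let τ := S.orderEmbOfFin hcard
  have hτmem : ∀ i, τ i ∈ S := fun i => Finset.orderEmbOfFin_mem S hcard i
  have hτsurj : ∀ x ∈ S, ∃ i, τ i = x := by
    intro x hx
    have : x ∈ Set.range τ := by rw [Finset.range_orderEmbOfFin]; exact hx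
    exact this
  have hmemIcc : ∀ x ∈ S, a ≤ x ∧ x ≤ b := by
    intro x hx
    rcases (hS x).1 hx with rfl | rfl | ⟨-, h⟩
    · exact ⟨le_rfl, hab.le⟩
    · exact ⟨hab.le, le_rfl⟩
    · exact ⟨h.1.le, h.2.le⟩
  have hτ0 : τ 0 = a := by
    obtain ⟨i, hi⟩ := hτsurj a ((hS a).2 (Or.inl rfl))
    refine le_antisymm ?_ (hmemIcc _ (hτmem 0)).1
    rw [← hi]
    exact τ.monotone (Fin.zero_le i)
  have hτl : τ (Fin.last _) = b := by
    obtain ⟨i, hi⟩ := hτsurj b ((hS b).2 (Or.inr (Or.inl rfl)))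
    refine le_antisymm (hmemIcc _ (hτmem _)).2 ?_
    rw [← hi]
    exact τ.monotone (Fin.le_last i)
  have hgap : ∀ j : Fin (S₀.card + 1), ∀ t ∈ Ioo (τ j.castSucc) (τ j.succ), t ∉ B := by
    intro j t ht htB
    have hta : a < t := (hmemIcc _ (hτmem _)).1.trans_lt ht.1
    have htb : t < b := ht.2.trans_le (hmemIcc _ (hτmem _)).2
    obtain ⟨i, rfl⟩ := hτsurj t ((hS t).2 (Or.inr (Or.inr ⟨htB, hta, htb⟩)))
    have h1 := τ.lt_iff_lt.1 ht.1
    have h2 := τ.lt_iff_lt.1 ht.2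
    rw [Fin.lt_def] at h1 h2
    simp at h1 h2
    omega
  have hlt : ∀ j : Fin (S₀.card + 1), τ j.castSucc < τ j.succ :=
    fun j => τ.strictMono (Fin.castSucc_lt_succ)
  choose v hv1 hv using fun j => h.segment _ _ (hlt j) (hgap j)
  refine ⟨by simpa using ha, by simpa using hb, S₀.card, fun j => τ j - a, v, ?_, ?_, ?_, ?_, ?_⟩
  · intro i j hij
    exact sub_lt_sub_right (τ.strictMono hij) a
  · simp [hτ0]
  · simp [hτl]
  · intro j
    refine ⟨hv1 j, ?_, ?_⟩
    · intro s hs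
      have := hv j (a + s) ⟨by linarith [hs.1], by linarith [hs.2]⟩
      simp only [add_sub_cancel]
      rw [this]
      congr 2
      ring
    · intro s hs
      have h1 : a + s ∈ Ioo (τ j.castSucc) (τ j.succ) := ⟨by linarith [hs.1], by linarith [hs.2]⟩
      have h2 : a + s ∈ Ioo a b := ⟨(hmemIcc _ (hτmem _)).1.trans_lt h1.1,
        h1.2.trans_le (hmemIcc _ (hτmem _)).2⟩
      exact (hin _ h2).resolve_right fun h3 => hgap j _ h1 h3.1
  · intro i
    simp only [add_sub_cancel]
    have hlt1 : τ i.castSucc.castSucc < τ i.succ.castSucc :=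
      τ.strictMono (by rw [Fin.lt_def]; simp)
    have hlt2 : τ i.succ.castSucc < τ i.succ.succ :=
      τ.strictMono (by rw [Fin.lt_def]; simp)
    have hab' : τ i.succ.castSucc ∈ Ioo a b :=
      ⟨(hmemIcc _ (hτmem _)).1.trans_lt hlt1, hlt2.trans_le (hmemIcc _ (hτmem _)).2⟩
    have hB : τ i.succ.castSucc ∈ B := by
      rcases (hS _).1 (hτmem i.succ.castSucc) with h | h | h
      · exact absurd h hab'.1.ne'
      · exact absurd h hab'.2.ne
      · exact h.1
    have hfr := ((hin _ hab').resolve_left (h.notMem _ hB)).2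
    refine ⟨hfr, ?_⟩
    obtain ⟨ν, V, W, hν, hVW, hV, hW⟩ := h.reflect _ hB hfr.1 hfr.2
    refine ⟨ν, hν, ?_⟩
    have hsucc : i.castSucc.succ = i.succ.castSucc := Fin.succ_castSucc i
    -- Both velocities describe the path at one earlier time close to the kink, so they agree. The
    -- same argument on the other side identifies the outgoing velocity.
    have e1 : v i.castSucc = V := by
      have hmem : ∀ᶠ s in 𝓝[<] (τ i.succ.castSucc), s ∈ Ioo (τ i.castSucc.castSucc)
        (τ i.succ.castSucc) := Ioo_mem_nhdsLT hlt1
      obtain ⟨s, hs, hs'⟩ := (hV.and hmem).exists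
      have h1 := hv i.castSucc s ⟨hs'.1.le, by rw [hsucc]; exact hs'.2.le⟩
      have h2 := hv i.castSucc (τ i.succ.castSucc) ⟨hlt1.le, by rw [hsucc]⟩
      have h3 : (s - τ i.succ.castSucc) • v i.castSucc = (s - τ i.succ.castSucc) • V := by
        rw [h1, h2] at hs
        have h4 : (s - τ i.succ.castSucc) • v i.castSucc =
          (s - τ i.castSucc.castSucc) • v i.castSucc -
            (τ i.succ.castSucc - τ i.castSucc.castSucc) • v i.castSucc := by
          rw [← sub_smul]; congr 1; ring
        rw [h4, sub_eq_iff_eq_add]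
        rw [add_assoc] at hs
        rw [add_comm ((s - τ i.succ.castSucc) • V)]
        exact add_left_cancel hs
      exact smul_right_injective _ (sub_ne_zero.2 hs'.2.ne) h3
    have e2 : v i.succ = W := by
      have hmem : ∀ᶠ s in 𝓝[>] (τ i.succ.castSucc), s ∈ Ioo (τ i.succ.castSucc)
        (τ i.succ.succ) := Ioo_mem_nhdsGT hlt2
      obtain ⟨s, hs, hs'⟩ := (hW.and hmem).exists
      have h1 := hv i.succ s ⟨hs'.1.le, hs'.2.le⟩
      rw [h1] at hs
      exact smul_right_injective _ (sub_ne_zero.2 hs'.1.ne') (add_left_cancel hs)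
    rw [e1, e2, hVW]

/-- If a function integrates to zero over every bounded component of an open set of reals, then it
integrates to zero over the set. -/
theorem setIntegral_eq_zero_of_components {U : Set ℝ} (hU : IsOpen U) {R : ℝ}
    (hR : ∀ t ∈ U, |t| ≤ R) {f : ℝ → ℝ} (hf : IntegrableOn f U)
    (h0 : ∀ a b, a < b → Ioo a b ⊆ U → a ∉ U → b ∉ U → ∫ t in Ioo a b, f t = 0) :
    ∫ t in U, f t = 0 := by
  have hcomp : ∀ x ∈ U, ∃ a b, a < x ∧ x < b ∧ Ioo a b ⊆ U ∧ a ∉ U ∧ b ∉ U := by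
    intro x hx
    -- The ends of the component of `x` are the nearest points of the complement on either side.
    -- They exist because `U` is bounded.
    let P := Iic x ∩ Uᶜ
    let Q := Ici x ∩ Uᶜ
    have hPc : IsClosed P := isClosed_Iic.inter hU.isClosed_compl
    have hQc : IsClosed Q := isClosed_Ici.inter hU.isClosed_compl
    have hxR := hR x hx
    have hPne : P.Nonempty := ⟨-(R + 1), by
      simp only [mem_Iic]; linarith [neg_abs_le x], fun h => by
        have := hR _ h
        rw [abs_neg] at this
        linarith [le_abs_self (R + 1)]⟩
    have hQne : Q.Nonempty := ⟨R + 1, by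
      simp only [mem_Ici]; linarith [le_abs_self x], fun h => by
        have := hR _ h
        linarith [le_abs_self (R + 1)]⟩
    have hPb : BddAbove P := ⟨x, fun y hy => hy.1⟩
    have hQb : BddBelow Q := ⟨x, fun y hy => hy.1⟩
    have hP := hPc.csSup_mem hPne hPb
    have hQ := hQc.csInf_mem hQne hQb
    refine ⟨sSup P, sInf Q, lt_of_le_of_ne hP.1 fun h => hP.2 (h ▸ hx),
      lt_of_le_of_ne hQ.1 fun h => hQ.2 (h ▸ hx), ?_, hP.2, hQ.2⟩
    intro y hy
    by_contra hyU
    rcases le_total y x with h | h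
    · exact absurd (le_csSup hPb ⟨h, hyU⟩) (not_le.2 hy.1)
    · exact absurd (csInf_le hQb ⟨h, hyU⟩) (not_le.2 hy.2)
  let I : Set (ℝ × ℝ) := {c | c.1 < c.2 ∧ Ioo c.1 c.2 ⊆ U ∧ c.1 ∉ U ∧ c.2 ∉ U}
  have hdisj : I.PairwiseDisjoint fun c => Ioo c.1 c.2 := by
    rintro ⟨a, b⟩ ⟨hab, hsub, ha, hb⟩ ⟨c, d⟩ ⟨hcd, hsub', hc, hd⟩ hne
    simp only at hab hsub ha hb hcd hsub' hc hd
    refine Set.disjoint_left.2 fun x hx hx' => hne ?_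
    have h1 : a = c := by
      rcases lt_trichotomy a c with h | h | h
      · exact absurd (hsub ⟨h, hx'.1.trans hx.2⟩) hc
      · exact h
      · exact absurd (hsub' ⟨h, hx.1.trans hx'.2⟩) ha
    have h2 : b = d := by
      rcases lt_trichotomy b d with h | h | h
      · exact absurd (hsub' ⟨hx'.1.trans hx.2, h⟩) hb
      · exact h
      · exact absurd (hsub ⟨hx.1.trans hx'.2, h⟩) hd
    rw [h1, h2]
  have hcount : I.Countable := hdisj.countable_of_isOpen (fun c _ => isOpen_Ioo)
    fun c hc => nonempty_Ioo.2 hc.1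
  have hun : U = ⋃ c ∈ I, Ioo c.1 c.2 := by
    ext x
    simp only [mem_iUnion, exists_prop]
    constructor
    · intro hx
      obtain ⟨a, b, h1, h2, h3, h4, h5⟩ := hcomp x hx
      exact ⟨(a, b), ⟨h1.trans h2, h3, h4, h5⟩, h1, h2⟩
    · rintro ⟨c, hc, hx⟩
      exact hc.2.1 hx
  have : Countable I := hcount.to_subtype
  rw [biUnion_eq_iUnion] at hun
  rw [hun] at hf ⊢
  rw [integral_iUnion (fun c : I => measurableSet_Ioo) (fun c d hcd => hdisj c.2 d.2
    (fun h => hcd (Subtype.ext h))) hf]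
  refine (tsum_congr fun c : I => ?_).trans tsum_zero
  exact h0 _ _ c.2.1 c.2.2.1 c.2.2.2.1 c.2.2.2.2

/-- The times spent in Ω, together with the reflections between them, form an open set whose
components are broken rays. The two functions have the same integral over each. -/
theorem IsReflectedPath.integral_eq_zero {n : ℕ} {Ω E : Set (Euc n)} {σ : ℝ → Euc n} {B : Set ℝ}
    (h : IsReflectedPath Ω E σ B) (hΩ : IsOpen Ω) {f₁ f₂ g₁ g₂ : Euc n → ℝ}
    (hg₁ : Measurable g₁) (hg₂ : Measurable g₂) {M : ℝ} (hM₁ : ∀ x, |g₁ x| ≤ M)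
    (hM₂ : ∀ x, |g₂ x| ≤ M) (hf₁ : EqOn f₁ g₁ (closure Ω)) (hf₂ : EqOn f₂ g₂ (closure Ω))
    (hsame : SameBrt Ω E f₁ f₂) :
    ∫ t, Ω.indicator (fun x => g₁ x - g₂ x) (σ t) = 0 := by
  have hσ := h.continuous
  obtain ⟨R, hR⟩ := h.bounded
  -- A kink at a reflecting point joins two excursions. A touch of `closure E` separates them, so
  -- that the resulting ray ends there.
  let U : Set ℝ := {t | (∀ᶠ s in 𝓝[≠] t, σ s ∈ Ω) ∧ (σ t ∈ Ω ∨ σ t ∉ closure E)}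
  have hnear : ∀ t, σ t ∈ Ω → ∀ᶠ s in 𝓝 t, σ s ∈ Ω := fun t ht =>
    hσ.continuousAt.eventually (hΩ.mem_nhds ht)
  have hΩU : ∀ t, σ t ∈ Ω → t ∈ U := fun t ht =>
    ⟨(hnear t ht).filter_mono nhdsWithin_le_nhds, Or.inl ht⟩
  have hUo : IsOpen U := by
    rw [isOpen_iff_mem_nhds]
    intro t ht
    have h1 : ∀ᶠ s in 𝓝 t, s ≠ t → σ s ∈ Ω := eventually_nhdsWithin_iff.1 ht.1
    filter_upwards [h1] with s hs
    by_cases hst : s = t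
    · rw [hst]; exact ht
    · exact hΩU s (hs hst)
  have hUcl : ∀ t ∈ U, σ t ∈ closure Ω := by
    intro t ht
    exact mem_closure_of_tendsto (hσ.continuousAt.tendsto.mono_left
      (nhdsWithin_le_nhds (s := {t}ᶜ))) ht.1
  have hUB : ∀ t ∈ U, σ t ∈ Ω ∨ (t ∈ B ∧ σ t ∈ frontier Ω \ closure E) := by
    intro t ht
    by_cases h1 : σ t ∈ Ω
    · exact Or.inl h1
    · have h2 := ht.2.resolve_left h1
      have h3 : σ t ∈ frontier Ω := by
        rw [hΩ.frontier_eq]; exact ⟨hUcl t ht, h1⟩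
      refine Or.inr ⟨?_, h3, h2⟩
      by_contra h4
      exact h2 (h.tomography t h4 h3)
  have hUR : ∀ t ∈ U, |t| ≤ R := by
    intro t ht
    refine le_of_tendsto (continuous_abs.continuousAt.tendsto.mono_left
      (nhdsWithin_le_nhds (s := {t}ᶜ))) ?_
    filter_upwards [ht.1] with s hs using hR s hs
  -- A component cannot end at a reflecting point: by `inside` the path would be in Ω on both sides
  -- of it, and the time would belong to `U`.
  have hend : ∀ t, t ∉ U → (∃ᶠ s in 𝓝[≠] t, s ∈ U) → σ t ∈ closure E := by
    intro t ht hfr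
    by_contra hE
    have hcl : σ t ∈ closure Ω := by
      have : σ t ∈ closure (closure Ω) := by
        refine mem_closure_of_frequently_of_tendsto (hfr.mono hUcl)
          (hσ.continuousAt.tendsto.mono_left nhdsWithin_le_nhds)
      rwa [closure_closure] at this
    have hn : σ t ∉ Ω := fun h1 => ht (hΩU t h1)
    have hf : σ t ∈ frontier Ω := by rw [hΩ.frontier_eq]; exact ⟨hcl, hn⟩
    have htB : t ∈ B := by
      by_contra h4
      exact hE (h.tomography t h4 hf)
    have hB : ∀ᶠ s in 𝓝[≠] t, s ∉ B := by
      have h5 : (B \ {t})ᶜ ∈ 𝓝 t :=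
        (h.finite.subset sdiff_subset).isClosed.isOpen_compl.mem_nhds (by simp)
      filter_upwards [nhdsWithin_le_nhds h5, self_mem_nhdsWithin] with s hs hs' hsB
      exact hs ⟨hsB, hs'⟩
    refine ht ⟨h.inside t htB hf hE ?_, Or.inr hE⟩
    refine (hfr.and_eventually hB).mono fun s hs => ?_
    exact (hUB s hs.1).resolve_right fun h6 => hs.2 h6.1
  have hM0 : 0 ≤ M := (abs_nonneg _).trans (hM₁ 0)
  have hDm : Measurable fun t => Ω.indicator (fun x => g₁ x - g₂ x) (σ t) :=
    ((hg₁.sub hg₂).indicator hΩ.measurableSet).comp hσ.measurable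
  have hU0 : ∀ t, t ∉ U → Ω.indicator (fun x => g₁ x - g₂ x) (σ t) = 0 := by
    intro t ht
    exact indicator_of_notMem (fun h1 => ht (hΩU t h1)) _
  have hUfin : volume U ≠ ⊤ := by
    refine ne_top_of_le_ne_top ?_ (measure_mono (t := Icc (-R) R) fun t ht => abs_le.1 (hUR t ht))
    simp
  rw [← setIntegral_eq_integral_of_forall_compl_eq_zero hU0]
  refine setIntegral_eq_zero_of_components hUo hUR ?_ ?_
  · refine Measure.integrableOn_of_bounded (M := 2 * M) hUfin hDm.aestronglyMeasurable
      (Eventually.of_forall fun t => ?_)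
    by_cases h1 : σ t ∈ Ω
    · rw [indicator_of_mem h1]
      refine (norm_sub_le _ _).trans ?_
      have := hM₁ (σ t)
      have := hM₂ (σ t)
      simp only [Real.norm_eq_abs]
      linarith
    · rw [indicator_of_notMem h1, norm_zero]; positivity
  · intro a b hab hsub ha hb
    have ha' : σ a ∈ closure E := hend a ha (by
      have h1 : ∃ᶠ s in 𝓝[>] a, s ∈ U := Eventually.frequently
        (mem_of_superset (Ioo_mem_nhdsGT hab) hsub)
      exact h1.filter_mono (nhdsWithin_mono _ fun x hx => ne_of_gt hx))
    have hb' : σ b ∈ closure E := hend b hb (by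
      have h1 : ∃ᶠ s in 𝓝[<] b, s ∈ U := Eventually.frequently
        (mem_of_superset (Ioo_mem_nhdsLT hab) hsub)
      exact h1.filter_mono (nhdsWithin_mono _ fun x hx => ne_of_lt hx))
    have hray := h.isBrokenRay hab (fun t ht => hUB t (hsub ht)) ha' hb'
    have heq := hsame _ _ hray
    have hbrt : ∀ f g : Euc n → ℝ, EqOn f g (closure Ω) →
        brt f (b - a) (fun s => σ (a + s)) = ∫ t in Ioo a b, g (σ t) := by
      intro f g hfg
      unfold brt
      rw [intervalIntegral.integral_comp_add_left (fun t => f (σ t)), add_zero, add_sub_cancel,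
        intervalIntegral.integral_of_le hab.le, integral_Ioc_eq_integral_Ioo]
      exact setIntegral_congr_fun measurableSet_Ioo fun t ht => hfg (hUcl t (hsub ht))
    rw [hbrt f₁ g₁ hf₁, hbrt f₂ g₂ hf₂] at heq
    have hint : ∀ g : Euc n → ℝ, Measurable g → (∀ x, |g x| ≤ M) →
        IntegrableOn (fun t => g (σ t)) (Ioo a b) := fun g hg hgM =>
      Measure.integrableOn_of_bounded (M := M) (by simp)
        (hg.comp hσ.measurable).aestronglyMeasurable (Eventually.of_forall fun t => hgM _)
    rw [← sub_eq_zero, ← integral_sub (hint g₁ hg₁ hM₁) (hint g₂ hg₂ hM₂)] at heq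
    rw [← heq]
    refine setIntegral_congr_ae measurableSet_Ioo ?_
    -- Within a component the path is off Ω only at kinks, which are finitely many.
    have hBnull : ∀ᵐ t : ℝ, t ∉ B := h.finite.measure_zero _ |> measure_eq_zero_iff_ae_notMem.1
    filter_upwards [hBnull] with t ht htab
    rw [indicator_of_mem ((hUB t (hsub htab)).resolve_right fun h6 => ht h6.1)]

/-! ### Domains bounded locally by a smooth hypersurface -/

theorem mem_of_segment_disjoint_frontier {n : ℕ} {Ω : Set (Euc n)} (hΩ : IsOpen Ω) {x y : Euc n}
    (hx : x ∈ Ω) (h : ∀ z ∈ segment ℝ x y, z ∉ frontier Ω) : y ∈ Ω := by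
  have hs : segment ℝ x y ⊆ Ω := by
    refine (convex_segment x y).isPreconnected.subset_of_closure_inter_subset hΩ
      ⟨x, left_mem_segment ℝ x y, hx⟩ ?_
    rintro z ⟨hz, hz'⟩
    by_contra hzΩ
    exact h z hz' (by rw [hΩ.frontier_eq]; exact ⟨hz, hzΩ⟩)
  exact hs (right_mem_segment ℝ x y)

/-- Strict differentiability holds uniformly over pairs of nearby points. The error constant is
chosen to consume half of the slope `ρ' m`. -/
theorem exists_ball_strictMono_along {n : ℕ} {ρ : Euc n → ℝ} {ρ' : Euc n →L[ℝ] ℝ} {q m : Euc n}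
    (hρ : HasStrictFDerivAt ρ ρ' q) (hm : 0 < ρ' m) :
    ∃ r > 0, ∀ x ∈ Metric.ball q r, ∀ s > 0, x + s • m ∈ Metric.ball q r →
      ρ x + s * (ρ' m / 2) ≤ ρ (x + s • m) := by
  have hm0 : m ≠ 0 := by rintro rfl; simp at hm
  have hn : 0 < ‖m‖ := norm_pos_iff.2 hm0
  have h1 := hρ.isLittleO.def (show 0 < ρ' m / (2 * ‖m‖) by positivity)
  obtain ⟨r, hr, h2⟩ := Metric.eventually_nhds_iff_ball.1 h1
  refine ⟨r, hr, fun x hx s hs hxs => ?_⟩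
  have h3 := h2 (x + s • m, x) (by
    rw [← ball_prod_same]; exact ⟨hxs, hx⟩)
  simp only [add_sub_cancel_left, map_smul, smul_eq_mul, norm_smul, Real.norm_eq_abs,
    abs_of_pos hs] at h3
  have h4 : ρ' m / (2 * ‖m‖) * (s * ‖m‖) = s * (ρ' m / 2) := by field_simp
  rw [h4] at h3
  have := (abs_le.1 h3).1
  linarith

/-- If near `q` the boundary of `Ω` lies on a smooth hypersurface, then near `q` either all or
none of the points on one side of it belong to `Ω`. -/
theorem eventually_mem_of_frequently_mem {n : ℕ} {Ω : Set (Euc n)} (hΩ : IsOpen Ω)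
    {ρ : Euc n → ℝ} {ρ' : Euc n →L[ℝ] ℝ} {q m : Euc n}
    (hρ : HasStrictFDerivAt ρ ρ' q) (hm : 0 < ρ' m) (hq : ρ q = 0)
    (hfr : ∀ᶠ y in 𝓝 q, y ∈ frontier Ω → ρ y = 0) (hfreq : ∃ᶠ y in 𝓝 q, 0 < ρ y ∧ y ∈ Ω) :
    ∀ᶠ y in 𝓝 q, 0 < ρ y → y ∈ Ω := by
  obtain ⟨r₁, hr₁, hmono⟩ := exists_ball_strictMono_along hρ hm
  obtain ⟨r₂, hr₂, hfr'⟩ := Metric.eventually_nhds_iff_ball.1 hfr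
  obtain ⟨r, hr, hrr₁, hrr₂⟩ : ∃ r, 0 < r ∧ r ≤ r₁ ∧ r ≤ r₂ :=
    ⟨min r₁ r₂, lt_min hr₁ hr₂, min_le_left _ _, min_le_right _ _⟩
  obtain ⟨δ, hδ, hδr⟩ : ∃ δ, 0 < δ ∧ δ * ‖m‖ < r / 2 := by
    refine ⟨r / 2 / (‖m‖ + 1), by positivity, ?_⟩
    rw [div_mul_eq_mul_div, div_lt_iff₀ (by positivity)]
    nlinarith [norm_nonneg m]
  -- So close to `q`, a shift by `δ • m` lifts every point to the positive side of ρ.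
  have hcont : ∀ᶠ x in 𝓝 q, -(δ * (ρ' m / 2)) < ρ x := by
    refine hρ.continuousAt.eventually (lt_mem_nhds ?_)
    rw [hq]
    have : 0 < δ * (ρ' m / 2) := by positivity
    linarith
  obtain ⟨r₃, hr₃, hc⟩ := Metric.eventually_nhds_iff_ball.1 hcont
  let r' := min (r / 2) r₃
  have hr' : 0 < r' := lt_min (by positivity) hr₃
  have hsh : ∀ x ∈ Metric.ball q r', ∀ s ∈ Icc 0 δ, x + s • m ∈ Metric.ball q r := by
    intro x hx s hs
    rw [mem_ball_iff_norm] at hx ⊢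
    have h1 : ‖x - q‖ < r / 2 := hx.trans_le (min_le_left _ _)
    have h2 : ‖s • m‖ ≤ δ * ‖m‖ := by
      rw [norm_smul, Real.norm_of_nonneg hs.1]
      exact mul_le_mul_of_nonneg_right hs.2 (norm_nonneg _)
    calc ‖x + s • m - q‖ = ‖(x - q) + s • m‖ := by congr 1; abel
      _ ≤ ‖x - q‖ + ‖s • m‖ := norm_add_le _ _
      _ < r := by linarith
  have hup : ∀ x ∈ Metric.ball q r', 0 < ρ x → ∀ s ∈ Icc 0 δ, 0 < ρ (x + s • m) := by
    intro x hx hx0 s hs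
    rcases hs.1.eq_or_lt with h | h
    · rw [← h]; simpa using hx0
    · have h1 := hmono x (Metric.ball_subset_ball hrr₁ (by simpa using hsh x hx 0 ⟨le_rfl, hδ.le⟩))
        s h (Metric.ball_subset_ball hrr₁ (hsh x hx s hs))
      have : 0 < s * (ρ' m / 2) := by positivity
      linarith
  have htop : ∀ x ∈ Metric.ball q r', 0 < ρ (x + δ • m) := by
    intro x hx
    have h1 := hmono x (Metric.ball_subset_ball hrr₁ (by simpa using hsh x hx 0 ⟨le_rfl, hδ.le⟩))
        δ hδ (Metric.ball_subset_ball hrr₁ (hsh x hx δ ⟨hδ.le, le_rfl⟩))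
    have := hc x (Metric.ball_subset_ball (min_le_right _ _) hx)
    linarith
  have hnf : ∀ z ∈ Metric.ball q r, 0 < ρ z → z ∉ frontier Ω := by
    intro z hz h0 hzf
    exact h0.ne' (hfr' z (Metric.ball_subset_ball hrr₂ hz) hzf)
  have hseg : ∀ x, ∀ z ∈ segment ℝ x (x + δ • m), ∃ s ∈ Icc 0 δ, z = x + s • m := by
    intro x z hz
    rw [segment_eq_image'] at hz
    obtain ⟨t, ht, rfl⟩ := hz
    refine ⟨t * δ, ⟨mul_nonneg ht.1 hδ.le, mul_le_of_le_one_left hδ.le ht.2⟩, ?_⟩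
    simp [smul_smul]
  have hball : ∀ᶠ y in 𝓝 q, y ∈ Metric.ball q r' := Metric.ball_mem_nhds q hr'
  obtain ⟨x, ⟨hx0, hxΩ⟩, hxb⟩ := (hfreq.and_eventually hball).exists
  filter_upwards [hball] with y hy hy0
  -- Join the known point `x` of Ω to `y` by going up along `m`, across at height `δ • m` and down
  -- again. Since ρ stays positive on this path, it never meets the boundary of Ω.
  have h1 : x + δ • m ∈ Ω := by
    refine mem_of_segment_disjoint_frontier hΩ hxΩ fun z hz => ?_
    obtain ⟨s, hs, rfl⟩ := hseg x z hz
    exact hnf _ (hsh x hxb s hs) (hup x hxb hx0 s hs)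
  have h2 : y + δ • m ∈ Ω := by
    refine mem_of_segment_disjoint_frontier hΩ h1 fun z hz => ?_
    have hz' : z - δ • m ∈ Metric.ball q r' := by
      have h3 : z - δ • m ∈ segment ℝ x y := by
        have := (mem_segment_translate ℝ (-(δ • m))).2 hz
        simpa [neg_add_eq_sub] using this
      exact (convex_ball q r').segment_subset hxb hy h3
    have h4 := htop _ hz'
    have h5 := hsh _ hz' δ ⟨hδ.le, le_rfl⟩
    rw [sub_add_cancel] at h4 h5
    exact hnf z h5 h4
  refine mem_of_segment_disjoint_frontier hΩ h2 fun z hz => ?_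
  rw [segment_symm] at hz
  obtain ⟨s, hs, rfl⟩ := hseg y z hz
  exact hnf _ (hsh y hy s hs) (hup y hy hy0 s hs)

/-- A point of the hypersurface is the limit of its shifts by small positive multiples of `m`, which
lie on the side filled by Ω. -/
theorem eventually_mem_closure_of_frequently_mem {n : ℕ} {Ω : Set (Euc n)} (hΩ : IsOpen Ω)
    {ρ : Euc n → ℝ} {ρ' : Euc n →L[ℝ] ℝ} {q m : Euc n}
    (hρ : HasStrictFDerivAt ρ ρ' q) (hm : 0 < ρ' m) (hq : ρ q = 0)
    (hfr : ∀ᶠ y in 𝓝 q, y ∈ frontier Ω → ρ y = 0) (hfreq : ∃ᶠ y in 𝓝 q, 0 < ρ y ∧ y ∈ Ω) :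
    ∀ᶠ y in 𝓝 q, ρ y = 0 → y ∈ closure Ω := by
  obtain ⟨r₁, hr₁, hmono⟩ := exists_ball_strictMono_along hρ hm
  have h1 := eventually_mem_of_frequently_mem hΩ hρ hm hq hfr hfreq
  obtain ⟨r₂, hr₂, h2⟩ := Metric.eventually_nhds_iff_ball.1 h1
  have hr : 0 < min r₁ r₂ := lt_min hr₁ hr₂
  filter_upwards [Metric.ball_mem_nhds q hr] with y hy hy0
  have hy1 := Metric.ball_subset_ball (min_le_left r₁ r₂) hy
  have htend : Tendsto (fun s : ℝ => y + s • m) (𝓝[>] 0) (𝓝 y) := by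
    have : Continuous fun s : ℝ => y + s • m := by fun_prop
    have h3 := this.tendsto 0
    rw [zero_smul, add_zero] at h3
    exact h3.mono_left nhdsWithin_le_nhds
  refine mem_closure_of_tendsto htend ?_
  filter_upwards [htend.eventually (Metric.isOpen_ball.mem_nhds hy), self_mem_nhdsWithin] with s hs hs0
  have h4 := hmono y hy1 s hs0 (Metric.ball_subset_ball (min_le_left r₁ r₂) hs)
  refine h2 _ (Metric.ball_subset_ball (min_le_right r₁ r₂) hs) ?_
  have : 0 < s * (ρ' m / 2) := mul_pos hs0 (by positivity)
  linarith

/-- The frontier is only assumed to lie on `ρ = 0`. Since Ω avoids `ρ = 0` near `q`, it accumulates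
at `q` from one side. It fills that side locally, so all of `ρ = 0` near `q` belongs to the
frontier. -/
theorem isUnitNormal_frontier {n : ℕ} {Ω : Set (Euc n)} (hΩ : IsOpen Ω) {ρ : Euc n → ℝ}
    {q ν : Euc n} {c : ℝ} (hν : ‖ν‖ = 1) (hρ : ContDiffAt ℝ 1 ρ q) (hc : c ≠ 0)
    (hgrad : HasGradientAt ρ (c • ν) q) (hq : ρ q = 0)
    (hfr : ∀ᶠ y in 𝓝 q, y ∈ frontier Ω → ρ y = 0) (hout : ∀ᶠ y in 𝓝 q, ρ y = 0 → y ∉ Ω)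
    (hqΩ : q ∈ frontier Ω) : IsUnitNormal (frontier Ω) q ν := by
  refine ⟨hν, ρ, c, hρ, hc, hgrad, hq, ?_⟩
  have hstr : HasStrictFDerivAt ρ (InnerProductSpace.toDual ℝ (Euc n) (c • ν)) q :=
    hρ.hasStrictFDerivAt' hgrad.hasFDerivAt one_ne_zero
  have hcν : 0 < (InnerProductSpace.toDual ℝ (Euc n) (c • ν)) (c • ν) := by
    rw [InnerProductSpace.toDual_apply_apply, real_inner_self_eq_norm_sq, norm_smul, hν]
    have : 0 < ‖c‖ := norm_pos_iff.2 hc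
    positivity
  have hfreq : ∃ᶠ y in 𝓝 q, y ∈ Ω := mem_closure_iff_frequently.1 (frontier_subset_closure hqΩ)
  have hcl : ∀ᶠ y in 𝓝 q, ρ y = 0 → y ∈ closure Ω := by
    have h1 : ∃ᶠ y in 𝓝 q, (0 < ρ y ∧ y ∈ Ω) ∨ (0 < (-ρ) y ∧ y ∈ Ω) := by
      refine (hfreq.and_eventually hout).mono fun y hy => ?_
      rcases lt_trichotomy (ρ y) 0 with h | h | h
      · exact Or.inr ⟨by simpa using h, hy.1⟩
      · exact absurd hy.1 (hy.2 h)
      · exact Or.inl ⟨h, hy.1⟩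
    rcases frequently_or_distrib.1 h1 with h | h
    · exact eventually_mem_closure_of_frequently_mem hΩ hstr hcν hq hfr h
    · have := eventually_mem_closure_of_frequently_mem hΩ hstr.neg (m := -(c • ν))
        (by rw [neg_apply, map_neg, neg_neg]; exact hcν) (by simpa using hq)
        (by filter_upwards [hfr] with y hy hy'; simpa using hy hy') h
      filter_upwards [this] with y hy hy'
      exact hy (by simpa using hy')
  filter_upwards [hfr, hout, hcl] with y h1 h2 h3
  refine ⟨h1, fun h => ?_⟩
  rw [hΩ.frontier_eq]
  exact ⟨h3 h, h2 h⟩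

/-! ### Unfolding lines in planes through the axis of a cone -/

/-- The point with polar coordinates `(r, θ)` in the plane through `v` spanned by `e` and `w`. -/
noncomputable def planePoint {n : ℕ} (v e w : Euc n) (r θ : ℝ) : Euc n :=
  v + r • (Real.cos θ • e + Real.sin θ • w)

/-- The triangle wave that folds the real line to the interval `[-α / 2, α / 2]`. -/
noncomputable def foldAngle (α θ : ℝ) : ℝ :=
  α / Real.pi * Real.arcsin (Real.sin (Real.pi * θ / α))

theorem continuous_foldAngle (α : ℝ) : Continuous (foldAngle α) := by
  unfold foldAngle
  have := Real.continuous_arcsin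
  fun_prop

theorem periodic_foldAngle {α : ℝ} (hα : 0 < α) : Function.Periodic (foldAngle α) (2 * α) := by
  intro θ
  have : Real.pi * (θ + 2 * α) / α = Real.pi * θ / α + 2 * Real.pi := by field_simp
  simp only [foldAngle, this, Real.sin_add_two_pi]

theorem neg_one_zpow_eq_one_or (k : ℤ) : (-1 : ℝ) ^ k = 1 ∨ (-1 : ℝ) ^ k = -1 := by
  rcases Int.even_or_odd k with h | h
  · exact Or.inl h.neg_one_zpow
  · exact Or.inr h.neg_one_zpow

/-- Shifting θ by `k * α` shifts the argument of the sine by `k * π`, which contributes the sign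
`(-1) ^ k`. On the remaining interval `arcsin` inverts `sin`. -/
theorem foldAngle_eq {α θ : ℝ} (hα : 0 < α) (k : ℤ) (h : |θ - k * α| ≤ α / 2) :
    foldAngle α θ = (-1) ^ k * (θ - k * α) := by
  have hpi := Real.pi_pos
  have h1 : Real.pi * θ / α = Real.pi * (θ - k * α) / α + k * Real.pi := by field_simp; ring
  have h2 : Real.arcsin (Real.sin (Real.pi * (θ - k * α) / α)) = Real.pi * (θ - k * α) / α := by
    obtain ⟨h3, h4⟩ := abs_le.1 h
    apply Real.arcsin_sin
    · rw [le_div_iff₀ hα]; nlinarith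
    · rw [div_le_iff₀ hα]; nlinarith
  have h5 : Real.arcsin ((-1) ^ k * Real.sin (Real.pi * (θ - k * α) / α)) =
      (-1) ^ k * (Real.pi * (θ - k * α) / α) := by
    rcases neg_one_zpow_eq_one_or k with h6 | h6
    · rw [h6, one_mul, one_mul, h2]
    · rw [h6, neg_one_mul, Real.arcsin_neg, h2, neg_one_mul]
  rw [foldAngle, h1, Real.sin_add_int_mul_pi, h5]
  field_simp

theorem abs_foldAngle_lt {α θ : ℝ} (hα : 0 < α) (h : Real.cos (Real.pi * θ / α) ≠ 0) :
    |foldAngle α θ| < α / 2 := by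
  have hpi := Real.pi_pos
  have hs : Real.sin (Real.pi * θ / α) ^ 2 < 1 := by
    have := Real.sin_sq_add_cos_sq (Real.pi * θ / α)
    have : 0 < Real.cos (Real.pi * θ / α) ^ 2 := by positivity
    linarith
  have hs' := (sq_lt_one_iff_abs_lt_one _).1 hs
  have h1 : Real.arcsin (Real.sin (Real.pi * θ / α)) < Real.pi / 2 :=
    Real.arcsin_lt_pi_div_two.2 (abs_lt.1 hs').2
  have h2 : -(Real.pi / 2) < Real.arcsin (Real.sin (Real.pi * θ / α)) :=
    Real.neg_pi_div_two_lt_arcsin.2 (abs_lt.1 hs').1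
  have h3 : α / 2 = α / Real.pi * (Real.pi / 2) := by field_simp
  have h4 : 0 < α / Real.pi := by positivity
  rw [foldAngle, abs_mul, abs_of_pos h4, h3]
  exact mul_lt_mul_of_pos_left (abs_lt.2 ⟨h2, h1⟩) h4

theorem cos_pi_mul_div_eq_zero_iff {α θ : ℝ} (hα : 0 < α) :
    Real.cos (Real.pi * θ / α) = 0 ↔ ∃ k : ℤ, θ = k * α + α / 2 := by
  have hpi := Real.pi_pos
  rw [Real.cos_eq_zero_iff]
  refine exists_congr fun k => ?_
  rw [div_eq_iff hα.ne']
  constructor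
  · intro h
    have : Real.pi * θ = Real.pi * (k * α + α / 2) := by rw [h]; ring
    exact mul_left_cancel₀ hpi.ne' this
  · rintro rfl; ring

/-- Cartesian form of the line with foot of the perpendicular at `p (cos ψ, sin ψ)` and direction
`(-sin ψ, cos ψ)`. -/
theorem sqrt_mul_cos_add_arctan {p : ℝ} (hp : 0 < p) (t ψ : ℝ) :
    √(p ^ 2 + t ^ 2) * Real.cos (ψ + Real.arctan (t / p)) = p * Real.cos ψ - t * Real.sin ψ ∧
    √(p ^ 2 + t ^ 2) * Real.sin (ψ + Real.arctan (t / p)) = p * Real.sin ψ + t * Real.cos ψ := by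
  have h1 : √(p ^ 2 + t ^ 2) = p * √(1 + (t / p) ^ 2) := by
    have : p ^ 2 + t ^ 2 = p ^ 2 * (1 + (t / p) ^ 2) := by field_simp
    rw [this, Real.sqrt_mul (by positivity), Real.sqrt_sq hp.le]
  have h2 : 0 < √(1 + (t / p) ^ 2) := Real.sqrt_pos.2 (by positivity)
  rw [Real.cos_add, Real.sin_add, Real.cos_arctan, Real.sin_arctan, h1]
  constructor <;> field_simp

/-- A line in the plane with polar coordinates, at distance `p` from the vertex, folded into the
sector `|θ| ≤ α / 2`. -/
noncomputable def foldedLine {n : ℕ} (v e w : Euc n) (α p φ t : ℝ) : Euc n :=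
  planePoint v e w (√(p ^ 2 + t ^ 2)) (foldAngle α (φ + Real.arctan (t / p)))

/-- The velocity of `foldedLine` on its `k`-th straight piece. -/
noncomputable def foldedVelocity {n : ℕ} (e w : Euc n) (α φ : ℝ) (k : ℤ) : Euc n :=
  -Real.sin (φ - k * α) • e + ((-1) ^ k * Real.cos (φ - k * α)) • w

section

variable {n : ℕ} {v e w : Euc n}

theorem cos_neg_one_zpow_mul (k : ℤ) (x : ℝ) : Real.cos ((-1) ^ k * x) = Real.cos x := by
  rcases neg_one_zpow_eq_one_or k with h | h <;> simp [h]

theorem sin_neg_one_zpow_mul (k : ℤ) (x : ℝ) :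
    Real.sin ((-1) ^ k * x) = (-1) ^ k * Real.sin x := by
  rcases neg_one_zpow_eq_one_or k with h | h <;> simp [h]

/-- On the `k`-th sheet, folding is a rotation by `-k * α`, followed by the reflection in the axis
if `k` is odd. It therefore maps lines to lines at the same speed. -/
theorem foldedLine_eq {α p φ t : ℝ} (hα : 0 < α) (hp : 0 < p) (k : ℤ)
    (h : |φ + Real.arctan (t / p) - k * α| ≤ α / 2) :
    foldedLine v e w α p φ t = v + (p * Real.cos (φ - k * α)) • e +
      ((-1) ^ k * (p * Real.sin (φ - k * α))) • w + t • foldedVelocity e w α φ k := by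
  have h1 : φ + Real.arctan (t / p) - k * α = φ - k * α + Real.arctan (t / p) := by ring
  obtain ⟨h2, h3⟩ := sqrt_mul_cos_add_arctan hp t (φ - k * α)
  rw [foldedLine, planePoint, foldAngle_eq hα k h, cos_neg_one_zpow_mul, sin_neg_one_zpow_mul, h1,
    smul_add, smul_smul, smul_smul, h2, mul_left_comm, h3, foldedVelocity]
  module

theorem norm_smul_add_smul (he : ‖e‖ = 1) (hw : ‖w‖ = 1) (hew : inner ℝ e w = 0) (a b : ℝ) :
    ‖a • e + b • w‖ ^ 2 = a ^ 2 + b ^ 2 := by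
  rw [← real_inner_self_eq_norm_sq]
  simp only [inner_add_left, inner_add_right, inner_smul_left, inner_smul_right,
    real_inner_self_eq_norm_sq, he, hw, hew, real_inner_comm e w]
  simp
  ring

theorem norm_planePoint_sub (he : ‖e‖ = 1) (hw : ‖w‖ = 1) (hew : inner ℝ e w = 0) {r : ℝ}
    (hr : 0 ≤ r) (θ : ℝ) : ‖planePoint v e w r θ - v‖ = r := by
  have h := norm_smul_add_smul he hw hew (Real.cos θ) (Real.sin θ)
  rw [Real.cos_sq_add_sin_sq, pow_eq_one_iff_of_nonneg (norm_nonneg _) two_ne_zero] at h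
  rw [planePoint, add_sub_cancel_left, norm_smul, h, Real.norm_of_nonneg hr, mul_one]

theorem norm_foldedVelocity (he : ‖e‖ = 1) (hw : ‖w‖ = 1) (hew : inner ℝ e w = 0) (α φ : ℝ)
    (k : ℤ) : ‖foldedVelocity e w α φ k‖ = 1 := by
  have h := norm_smul_add_smul he hw hew (-Real.sin (φ - k * α)) ((-1) ^ k * Real.cos (φ - k * α))
  have hk : ((-1 : ℝ) ^ k) ^ 2 = 1 := by
    rcases neg_one_zpow_eq_one_or k with h | h <;> simp [h]
  rw [mul_pow, hk, one_mul, neg_sq, Real.sin_sq_add_cos_sq,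
    pow_eq_one_iff_of_nonneg (norm_nonneg _) two_ne_zero] at h
  exact h

/-- Law of reflection: sheets `k` and `k + 1` meet along the edge at angle `(-1) ^ k * (α / 2)`,
whose unit normal in the plane is the vector displayed. -/
theorem foldedVelocity_succ (he : ‖e‖ = 1) (hw : ‖w‖ = 1) (hew : inner ℝ e w = 0) (α φ : ℝ)
    (k : ℤ) : foldedVelocity e w α φ (k + 1) = foldedVelocity e w α φ k -
      (2 * inner ℝ (foldedVelocity e w α φ k)
        (-Real.sin (α / 2) • e + ((-1) ^ k * Real.cos (α / 2)) • w)) •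
          (-Real.sin (α / 2) • e + ((-1) ^ k * Real.cos (α / 2)) • w) := by
  have hk : ((-1 : ℝ) ^ k) * (-1) ^ k = 1 := by
    rcases neg_one_zpow_eq_one_or k with h | h <;> simp [h]
  have hin : inner ℝ (foldedVelocity e w α φ k)
        (-Real.sin (α / 2) • e + ((-1) ^ k * Real.cos (α / 2)) • w) =
      Real.cos (φ - k * α - α / 2) := by
    simp only [foldedVelocity, inner_add_left, inner_add_right, inner_smul_left, inner_smul_right,
      real_inner_self_eq_norm_sq, he, hw, hew, real_inner_comm e w, conj_trivial]
    rw [Real.cos_sub (φ - k * α)]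
    linear_combination (Real.cos (φ - k * α) * Real.cos (α / 2)) * hk
  rw [hin]
  have h1 : -Real.sin (φ - (k + 1 : ℤ) * α) = -Real.sin (φ - k * α) -
      (2 * Real.cos (φ - k * α - α / 2)) * -Real.sin (α / 2) := by
    have : φ - (k + 1 : ℤ) * α = (φ - k * α - α / 2) - α / 2 := by push_cast; ring
    rw [this]
    have h2 : Real.sin (φ - k * α) = Real.sin ((φ - k * α - α / 2) + α / 2) := by congr 1; ring
    rw [h2, Real.sin_sub, Real.sin_add]
    ring
  have h3 : (-1) ^ (k + 1) * Real.cos (φ - (k + 1 : ℤ) * α) = (-1) ^ k * Real.cos (φ - k * α) -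
      (2 * Real.cos (φ - k * α - α / 2)) * ((-1) ^ k * Real.cos (α / 2)) := by
    have : φ - (k + 1 : ℤ) * α = (φ - k * α - α / 2) - α / 2 := by push_cast; ring
    rw [this, zpow_add_one₀ (by norm_num)]
    have h2 : Real.cos (φ - k * α) = Real.cos ((φ - k * α - α / 2) + α / 2) := by congr 1; ring
    rw [h2, Real.cos_sub (φ - k * α - α / 2), Real.cos_add]
    ring
  rw [foldedVelocity, h1, h3, foldedVelocity]
  module

theorem inner_planePoint_sub (he : ‖e‖ = 1) (hew : inner ℝ e w = 0) (r θ : ℝ) :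
    inner ℝ (planePoint v e w r θ - v) e = r * Real.cos θ := by
  simp [planePoint, inner_add_left, inner_smul_left, he,
    real_inner_comm e w, hew]

theorem angle_planePoint (he : ‖e‖ = 1) (hw : ‖w‖ = 1) (hew : inner ℝ e w = 0) {r : ℝ}
    (hr : 0 < r) {θ : ℝ} (hθ : |θ| ≤ Real.pi) :
    InnerProductGeometry.angle (planePoint v e w r θ - v) e = |θ| := by
  rw [InnerProductGeometry.angle, inner_planePoint_sub he hew, norm_planePoint_sub he hw hew hr.le,
    he, mul_one, mul_div_cancel_left₀ _ hr.ne', ← Real.cos_abs,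
    Real.arccos_cos (abs_nonneg θ) hθ]

theorem planePoint_mem_openCone_iff (he : ‖e‖ = 1) (hw : ‖w‖ = 1) (hew : inner ℝ e w = 0) {r : ℝ}
    (hr : 0 < r) {θ : ℝ} (hθ : |θ| ≤ Real.pi) {α : ℝ} :
    planePoint v e w r θ ∈ openCone v e α ↔ |θ| < α / 2 := by
  have hne : planePoint v e w r θ ≠ v := by
    intro h
    have := norm_planePoint_sub (v := v) he hw hew hr.le θ
    rw [h, sub_self, norm_zero] at this
    exact hr.ne this
  change _ ∧ _ ↔ _
  rw [angle_planePoint he hw hew hr hθ]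
  exact and_iff_right hne

theorem continuousAt_angle_sub {u x : Euc n} (hx : x ≠ v) (hu : u ≠ 0) :
    ContinuousAt (fun y : Euc n => InnerProductGeometry.angle (y - v) u) x := by
  have h3 : ContinuousAt (fun y : Euc n => (y - v, u)) x := by fun_prop
  exact ContinuousAt.comp (f := fun y : Euc n => (y - v, u))
    (InnerProductGeometry.continuousAt_angle (sub_ne_zero.2 hx) hu) h3

theorem isOpen_openCone {u : Euc n} (hu : u ≠ 0) (α : ℝ) : IsOpen (openCone v u α) := by
  rw [isOpen_iff_mem_nhds]
  rintro x ⟨hx, hxα⟩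
  have h1 := continuousAt_angle_sub hx hu
  exact Filter.inter_mem (isOpen_ne.mem_nhds hx) (h1.eventually (gt_mem_nhds hxα))

theorem angle_eq_of_mem_frontier_openCone {u x : Euc n} (hu : u ≠ 0) {α : ℝ}
    (hx : x ∈ frontier (openCone v u α)) :
    x = v ∨ InnerProductGeometry.angle (x - v) u = α / 2 := by
  by_cases hxv : x = v
  · exact Or.inl hxv
  refine Or.inr (le_antisymm ?_ ?_)
  · have h1 := continuousAt_angle_sub hxv hu
    by_contra h
    have h4 := h1.eventually (lt_mem_nhds (not_le.1 h))
    obtain ⟨y, hy, hy'⟩ := ((mem_closure_iff_frequently.1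
      (frontier_subset_closure hx)).and_eventually h4).exists
    exact absurd hy.2 (not_lt.2 hy'.le)
  · by_contra h
    rw [(isOpen_openCone hu α).frontier_eq] at hx
    exact hx.2 ⟨hxv, not_le.1 h⟩

end

/-! ### Defining functions of the cone boundary, and folded lines as reflected paths. -/

section

variable {n : ℕ} {v e w : Euc n}

/-- With `κ = cos (α / 2)` this function vanishes on the boundary of the cone. At such a point its
gradient lies in the plane through that point and the axis. -/
theorem hasGradientAt_cone_function {q : Euc n} (hq : q ≠ v) (e : Euc n) (κ : ℝ) :
    HasGradientAt (fun y => inner ℝ (y - v) e - κ * ‖y - v‖) (e - (κ / ‖q - v‖) • (q - v)) q := by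
  have hq' : 0 < ‖q - v‖ := norm_pos_iff.2 (sub_ne_zero.2 hq)
  have h1 : HasFDerivAt (fun y : Euc n => y - v) (ContinuousLinearMap.id ℝ (Euc n)) q :=
    (hasFDerivAt_id q).sub_const v
  have h2 := (h1.norm_sq).sqrt (by positivity)
  have h3 := h1.inner ℝ (hasFDerivAt_const e q)
  have h4 := h3.sub (h2.const_mul κ)
  rw [hasGradientAt_iff_hasFDerivAt]
  refine (h4.congr_fderiv ?_).congr_of_eventuallyEq (Eventually.of_forall fun y => ?_)
  · ext z
    simp only [Real.sqrt_sq hq'.le]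
    simp [real_inner_comm]
    field_simp
  · simp [Real.sqrt_sq (norm_nonneg _)]

theorem contDiffAt_cone_function {q : Euc n} (hq : q ≠ v) (e : Euc n) (κ : ℝ) :
    ContDiffAt ℝ 1 (fun y => inner ℝ (y - v) e - κ * ‖y - v‖) q := by
  have h1 : ContDiffAt ℝ 1 (fun y : Euc n => y - v) q := by fun_prop
  have h2 := h1.norm ℝ (sub_ne_zero.2 hq)
  exact (h1.inner ℝ contDiffAt_const).sub (contDiffAt_const.mul h2)

theorem inner_eq_of_angle_eq (he : ‖e‖ = 1) {x : Euc n} {β : ℝ}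
    (h : InnerProductGeometry.angle x e = β) : inner ℝ x e = Real.cos β * ‖x‖ := by
  have := InnerProductGeometry.cos_angle_mul_norm_mul_norm x e
  rw [h, he, mul_one] at this
  exact this.symm

theorem eq_smul_add_smul_of_dim_two {e w : Euc 2} (he : ‖e‖ = 1) (hw : ‖w‖ = 1)
    (hew : inner ℝ e w = 0) (x : Euc 2) : x = (inner ℝ x e) • e + (inner ℝ x w) • w := by
  have ho : Orthonormal ℝ ![e, w] := by
    rw [orthonormal_iff_ite]
    intro i j
    fin_cases i <;> fin_cases j <;>
      simp [he, hw, hew, real_inner_comm e w]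
  let b := (basisOfOrthonormalOfCardEqFinrank ho (by simp)).toOrthonormalBasis (by simpa using ho)
  have := b.sum_repr' x
  rw [Fin.sum_univ_two] at this
  simp only [b, Module.Basis.coe_toOrthonormalBasis,
    coe_basisOfOrthonormalOfCardEqFinrank, Matrix.cons_val_zero, Matrix.cons_val_one] at this
  rw [real_inner_comm e x, real_inner_comm w x] at *
  exact this.symm

/-- Near a boundary point off the vertex a cone is one side or both sides of a smooth
hypersurface. -/
theorem exists_defining_function (he : ‖e‖ = 1) (hw : ‖w‖ = 1) (hew : inner ℝ e w = 0) {α : ℝ}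
    (hα : 0 < α) (hα2 : α ≤ 2 * Real.pi) (hn : α < 2 * Real.pi ∨ n = 2) {r : ℝ} (hr : 0 < r) {ε : ℝ}
    (hε : ε = 1 ∨ ε = -1) :
    ∃ (ρ : Euc n → ℝ) (c : ℝ), ContDiffAt ℝ 1 ρ (planePoint v e w r (ε * (α / 2))) ∧ c ≠ 0 ∧
      HasGradientAt ρ (c • (-Real.sin (α / 2) • e + (ε * Real.cos (α / 2)) • w))
        (planePoint v e w r (ε * (α / 2))) ∧
      ρ (planePoint v e w r (ε * (α / 2))) = 0 ∧
      (∀ y ∈ frontier (openCone v e α), ρ y = 0) ∧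
      (∀ᶠ y in 𝓝 (planePoint v e w r (ε * (α / 2))), ρ y = 0 → y ∉ openCone v e α) ∧
      ∀ r' ψ, 0 < r' → |ψ| < α / 2 → 0 < ε * ψ → 0 < ρ (planePoint v e w r' ψ) := by
  have hpi := Real.pi_pos
  have he0 : e ≠ 0 := by rintro rfl; simp at he
  have hcos : Real.cos (ε * (α / 2)) = Real.cos (α / 2) := by rcases hε with rfl | rfl <;> simp
  have hsin : Real.sin (ε * (α / 2)) = ε * Real.sin (α / 2) := by
    rcases hε with rfl | rfl <;> simp
  have hnorm := norm_planePoint_sub (v := v) he hw hew hr.le (ε * (α / 2))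
  have hne : planePoint v e w r (ε * (α / 2)) ≠ v := by
    intro h
    rw [h, sub_self, norm_zero] at hnorm
    exact hr.ne hnorm
  -- Below `2π` the cone function is regular on the boundary, with gradient of length `sin (α / 2) >
  -- 0`. At `2π` it degenerates. In the plane a linear function takes its place, whose sign `ε`
  -- selects one side of the slit.
  rcases hα2.lt_or_eq with hlt | heq
  · have hs : 0 < Real.sin (α / 2) := Real.sin_pos_of_pos_of_lt_pi (by positivity) (by linarith)
    refine ⟨fun y => inner ℝ (y - v) e - Real.cos (α / 2) * ‖y - v‖, -Real.sin (α / 2),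
      contDiffAt_cone_function hne e _, by linarith, ?_, ?_, ?_, ?_, ?_⟩
    · convert hasGradientAt_cone_function hne e (Real.cos (α / 2)) using 1
      rw [hnorm, planePoint, add_sub_cancel_left, smul_smul, div_mul_cancel₀ _ hr.ne', hcos, hsin]
      have h1 := Real.sin_sq_add_cos_sq (α / 2)
      have h2 : e = (Real.sin (α / 2) ^ 2 + Real.cos (α / 2) ^ 2) • e := by rw [h1, one_smul]
      nth_rewrite 2 [h2]
      module
    · simp only
      rw [inner_planePoint_sub he hew, hnorm, hcos]
      ring
    · intro y hy
      rcases angle_eq_of_mem_frontier_openCone he0 hy with rfl | h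
      · simp
      · simp only
        rw [inner_eq_of_angle_eq he h, sub_self]
    · refine Eventually.of_forall fun y hy hyC => ?_
      have h1 := inner_eq_of_angle_eq he (x := y - v) rfl
      have h2 : Real.cos (α / 2) < Real.cos (InnerProductGeometry.angle (y - v) e) :=
        Real.cos_lt_cos_of_nonneg_of_le_pi (InnerProductGeometry.angle_nonneg _ _)
          (by linarith) hyC.2
      have h3 : 0 < ‖y - v‖ := norm_pos_iff.2 (sub_ne_zero.2 hyC.1)
      simp only [h1] at hy
      nlinarith
    · intro r' ψ hr' hψ _
      simp only
      rw [inner_planePoint_sub he hew, norm_planePoint_sub he hw hew hr'.le]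
      have h2 : Real.cos (α / 2) < Real.cos ψ := by
        rw [← Real.cos_abs ψ]
        exact Real.cos_lt_cos_of_nonneg_of_le_pi (abs_nonneg _) (by linarith) hψ
      nlinarith
  · have hn2 : n = 2 := hn.resolve_left heq.not_lt
    subst hn2
    have hα' : α / 2 = Real.pi := by linarith
    have hdec := eq_smul_add_smul_of_dim_two he hw hew
    have hiw : ∀ r θ, inner ℝ (planePoint v e w r θ - v) w = r * Real.sin θ := by
      intro r θ
      simp [planePoint, inner_add_left, inner_smul_left, hew, hw]
    refine ⟨fun y => ε * inner ℝ (y - v) w, -1, ?_, by norm_num, ?_, ?_, ?_, ?_, ?_⟩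
    · have h1 : ContDiffAt ℝ 1 (fun y : Euc 2 => y - v) (planePoint v e w r (ε * (α / 2))) := by
        fun_prop
      exact contDiffAt_const.mul (h1.inner ℝ contDiffAt_const)
    · rw [hasGradientAt_iff_hasFDerivAt]
      have h1 : HasFDerivAt (fun y : Euc 2 => y - v) (ContinuousLinearMap.id ℝ (Euc 2))
        (planePoint v e w r (ε * (α / 2))) := (hasFDerivAt_id _).sub_const v
      refine ((h1.inner ℝ (hasFDerivAt_const w _)).const_mul ε).congr_fderiv ?_
      ext z
      simp [hα', real_inner_comm]
    · simp only
      rw [hiw, hα']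
      rcases hε with rfl | rfl <;> simp
    · intro y hy
      rcases angle_eq_of_mem_frontier_openCone he0 hy with rfl | h
      · simp
      · rw [hα'] at h
        obtain ⟨-, c, -, hc⟩ := InnerProductGeometry.angle_eq_pi_iff.1
          ((InnerProductGeometry.angle_comm _ _).trans h)
        simp only
        rw [hc, inner_smul_left, hew, mul_zero, mul_zero]
    -- The zero line of the linear function also contains points of the cone, on the far side of the
    -- vertex. Near the given point only the slit is seen.
    · have hneg : ∀ᶠ y in 𝓝 (planePoint v e w r (ε * (α / 2))), inner ℝ (y - v) e < 0 := by
        have hc : Continuous fun y : Euc 2 => inner ℝ (y - v) e := by fun_prop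
        refine hc.continuousAt.eventually (gt_mem_nhds ?_)
        simp only
        rw [inner_planePoint_sub he hew, hcos, hα', Real.cos_pi]
        linarith
      filter_upwards [hneg] with y hy hy0 hyC
      have h1 : inner ℝ (y - v) w = 0 := by
        rcases hε with rfl | rfl <;> simpa using hy0
      have h2 := hdec (y - v)
      rw [h1, zero_smul, add_zero] at h2
      have h3 := hyC.2
      rw [h2, InnerProductGeometry.angle_smul_left_of_neg _ _ hy,
        InnerProductGeometry.angle_neg_self_of_nonzero he0, hα'] at h3
      exact lt_irrefl _ h3
    · intro r' ψ hr' hψ hεψ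
      simp only
      rw [hiw, mul_left_comm]
      refine mul_pos hr' ?_
      have : ε * Real.sin ψ = Real.sin (ε * ψ) := by rcases hε with rfl | rfl <;> simp
      rw [this]
      refine Real.sin_pos_of_pos_of_lt_pi hεψ ?_
      rw [hα'] at hψ
      rcases hε with rfl | rfl
      · linarith [(abs_lt.1 hψ).2]
      · linarith [(abs_lt.1 hψ).1]

theorem continuous_planePoint {X : Type*} [TopologicalSpace X] {r θ : X → ℝ} (hr : Continuous r)
    (hθ : Continuous θ) : Continuous fun x => planePoint v e w (r x) (θ x) := by
  unfold planePoint
  fun_prop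

/-- The kinks are exactly the times at which the folded line is on the boundary of the cone.
Elsewhere it is in the open cone, where the frontier of Ω belongs to `E`. -/
theorem isReflectedPath_foldedLine (he : ‖e‖ = 1) (hw : ‖w‖ = 1) (hew : inner ℝ e w = 0) {α : ℝ}
    (hα : 0 < α) (hα2 : α ≤ 2 * Real.pi) (hn : α < 2 * Real.pi ∨ n = 2) {Ω E : Set (Euc n)}
    (hΩ : IsOpen Ω) (hb : Bornology.IsBounded Ω) (hC : Ω ⊆ openCone v e α)
    (hE : frontier Ω \ E ⊆ frontier (openCone v e α)) {p : ℝ} (hp : 0 < p) (φ : ℝ) :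
    IsReflectedPath Ω E (foldedLine v e w α p φ)
      {t | Real.cos (Real.pi * (φ + Real.arctan (t / p)) / α) = 0} := by
  have hpi := Real.pi_pos
  have he0 : e ≠ 0 := by rintro rfl; simp at he
  let θ : ℝ → ℝ := fun t => φ + Real.arctan (t / p)
  have hθc : Continuous θ := by
    have := Real.continuous_arctan
    fun_prop
  have hθm : StrictMono θ := by
    intro s t hst
    have : s / p < t / p := div_lt_div_of_pos_right hst hp
    have := Real.arctan_strictMono this
    simp only [θ]
    linarith
  have hrpos : ∀ t : ℝ, 0 < √(p ^ 2 + t ^ 2) := fun t => Real.sqrt_pos.2 (by positivity)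
  have hcont : Continuous (foldedLine v e w α p φ) :=
    continuous_planePoint (by fun_prop) ((continuous_foldAngle α).comp hθc)
  let B : Set ℝ := {t | Real.cos (Real.pi * θ t / α) = 0}
  have hBiff : ∀ t, t ∈ B ↔ ∃ k : ℤ, θ t = k * α + α / 2 :=
    fun t => cos_pi_mul_div_eq_zero_iff hα
  -- The angle increases strictly through an interval of length π, so it meets only finitely many
  -- edges, each at most once.
  have hBfin : B.Finite := by
    have hfl : ∀ t (k : ℤ), θ t = k * α + α / 2 → ⌊θ t / α⌋ = k := by
      intro t k hk
      rw [Int.floor_eq_iff, hk]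
      constructor
      · rw [le_div_iff₀ hα]; linarith
      · rw [div_lt_iff₀ hα]; linarith
    refine Set.Finite.of_injOn (f := fun t => ⌊θ t / α⌋)
      (t := Icc ⌊(φ - Real.pi / 2) / α⌋ ⌊(φ + Real.pi / 2) / α⌋) ?_ ?_ (finite_Icc _ _)
    · intro t _
      have h1 := Real.arctan_lt_pi_div_two (t / p)
      have h2 := Real.neg_pi_div_two_lt_arctan (t / p)
      constructor
      · refine Int.floor_le_floor (div_le_div_of_nonneg_right ?_ hα.le)
        simp only [θ]; linarith
      · refine Int.floor_le_floor (div_le_div_of_nonneg_right ?_ hα.le)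
        simp only [θ]; linarith
    · intro s hs t ht hst
      obtain ⟨k, hk⟩ := (hBiff s).1 hs
      obtain ⟨l, hl⟩ := (hBiff t).1 ht
      simp only [hfl s k hk, hfl t l hl] at hst
      apply hθm.injective
      rw [hk, hl, hst]
  have hnotB : ∀ t, t ∉ B → foldedLine v e w α p φ t ∈ openCone v e α := by
    intro t ht
    have h1 := abs_foldAngle_lt hα (θ := θ t) ht
    exact (planePoint_mem_openCone_iff he hw hew (hrpos t) (by linarith)).2 h1
  have hkink : ∀ t (k : ℤ), θ t = k * α + α / 2 →
      foldedLine v e w α p φ t = planePoint v e w (√(p ^ 2 + t ^ 2)) ((-1) ^ k * (α / 2)) := by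
    intro t k hk
    have h1 : |θ t - k * α| ≤ α / 2 := by
      rw [hk, add_sub_cancel_left, abs_of_pos (by positivity)]
    have h2 := foldAngle_eq hα k h1
    rw [hk, add_sub_cancel_left, ← hk] at h2
    rw [foldedLine]
    change planePoint v e w _ (foldAngle α (θ t)) = _
    rw [h2]
  have hBnot : ∀ t ∈ B, foldedLine v e w α p φ t ∉ openCone v e α := by
    intro t ht
    obtain ⟨k, hk⟩ := (hBiff t).1 ht
    have habs : |(-1 : ℝ) ^ k * (α / 2)| = α / 2 := by
      rw [abs_mul, abs_neg_one_zpow, one_mul, abs_of_pos (by positivity)]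
    rw [hkink t k hk, planePoint_mem_openCone_iff he hw hew (hrpos t) (by rw [habs]; linarith), habs]
    exact lt_irrefl _
  have hlocal : ∀ t ∈ B, foldedLine v e w α p φ t ∉ closure E → ∃ k : ℤ, θ t = k * α + α / 2 ∧
      ∃ (ρ : Euc n → ℝ) (c : ℝ), ContDiffAt ℝ 1 ρ (foldedLine v e w α p φ t) ∧ c ≠ 0 ∧
      HasGradientAt ρ (c • (-Real.sin (α / 2) • e + ((-1) ^ k * Real.cos (α / 2)) • w))
        (foldedLine v e w α p φ t) ∧ ρ (foldedLine v e w α p φ t) = 0 ∧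
      (∀ᶠ y in 𝓝 (foldedLine v e w α p φ t), y ∈ frontier Ω → ρ y = 0) ∧
      (∀ᶠ y in 𝓝 (foldedLine v e w α p φ t), ρ y = 0 → y ∉ Ω) ∧
      (∀ᶠ s in 𝓝[≠] t, 0 < ρ (foldedLine v e w α p φ s)) := by
    intro t ht htE
    obtain ⟨k, hk⟩ := (hBiff t).1 ht
    refine ⟨k, hk, ?_⟩
    obtain ⟨ρ, c, h1, h2, h3, h4, h5, h6, h7⟩ := exists_defining_function (v := v) he hw hew hα hα2
      hn (hrpos t) (neg_one_zpow_eq_one_or k)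
    rw [← hkink t k hk] at h1 h3 h4 h6
    refine ⟨ρ, c, h1, h2, h3, h4, ?_, ?_, ?_⟩
    -- Away from `closure E` the frontier of Ω is contained in that of the cone.
    · filter_upwards [isClosed_closure.isOpen_compl.mem_nhds htE] with y hy hyf
      exact h5 y (hE ⟨hyf, fun h => hy (subset_closure h)⟩)
    · filter_upwards [h6] with y hy hy0 hyΩ
      exact hy hy0 (hC hyΩ)
    · have hB : ∀ᶠ s in 𝓝[≠] t, s ∉ B := by
        have h5 : (B \ {t})ᶜ ∈ 𝓝 t :=
          (hBfin.subset sdiff_subset).isClosed.isOpen_compl.mem_nhds (by simp)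
        filter_upwards [nhdsWithin_le_nhds h5, self_mem_nhdsWithin] with s hs hs' hsB
        exact hs ⟨hsB, hs'⟩
      -- Before and after the kink, the folded line is on the same side of the edge. This matters
      -- for the slit plane, whose two sides are both in the cone.
      have hpos : ∀ᶠ s in 𝓝 t, 0 < (-1) ^ k * foldAngle α (θ s) := by
        have hc : Continuous fun s => (-1) ^ k * foldAngle α (θ s) :=
          continuous_const.mul ((continuous_foldAngle α).comp hθc)
        refine hc.continuousAt.eventually (lt_mem_nhds ?_)
        simp only
        rw [foldAngle_eq hα k (θ := θ t) (by rw [hk, add_sub_cancel_left, abs_of_pos (by positivity)]), hk,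
          add_sub_cancel_left]
        rcases neg_one_zpow_eq_one_or k with h | h <;> rw [h] <;> linarith
      filter_upwards [hB, nhdsWithin_le_nhds hpos] with s hs hs'
      exact h7 _ _ (hrpos s) (abs_foldAngle_lt hα hs) hs'
  refine ⟨hcont, hBfin, ?_, fun t ht h => hBnot t ht (hC h), ?_, ?_, ?_, ?_⟩
  · intro x y hxy hno
    let m := (x + y) / 2
    have hxm : x < m := by simp only [m]; linarith
    have hmy : m < y := by simp only [m]; linarith
    -- The sheet is read off at the midpoint. Leaving it would cross an edge angle at a time
    -- strictly inside the interval, hence produce a kink.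
    let k := round (θ m / α)
    have hk : |θ m - k * α| ≤ α / 2 := by
      have h1 := abs_sub_round (θ m / α)
      have h2 : θ m - k * α = (θ m / α - k) * α := by field_simp
      rw [h2, abs_mul, abs_of_pos hα]
      calc |θ m / α - k| * α ≤ 1 / 2 * α := mul_le_mul_of_nonneg_right h1 hα.le
        _ = α / 2 := by ring
    obtain ⟨hk1, hk2⟩ := abs_le.1 hk
    have hall : ∀ s ∈ Icc x y, |θ s - k * α| ≤ α / 2 := by
      intro s hs
      rw [abs_le]
      constructor
      · by_contra h
        have h' : θ s < ((k - 1 : ℤ) : ℝ) * α + α / 2 := by push_cast; linarith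
        have h'' : ((k - 1 : ℤ) : ℝ) * α + α / 2 ≤ θ m := by push_cast; linarith
        have hsm : s < m := hθm.lt_iff_lt.1 (h'.trans_le h'')
        obtain ⟨t, ht, hθt⟩ := intermediate_value_Icc hsm.le hθc.continuousOn ⟨h'.le, h''⟩
        have hst : s < t := hθm.lt_iff_lt.1 (by rw [hθt]; exact h')
        exact hno t ⟨hs.1.trans_lt hst, ht.2.trans_lt hmy⟩ ((hBiff t).2 ⟨_, hθt⟩)
      · by_contra h
        have h' : (k : ℝ) * α + α / 2 < θ s := by linarith
        have h'' : θ m ≤ (k : ℝ) * α + α / 2 := by linarith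
        have hsm : m < s := hθm.lt_iff_lt.1 (h''.trans_lt h')
        obtain ⟨t, ht, hθt⟩ := intermediate_value_Icc hsm.le hθc.continuousOn ⟨h'', h'.le⟩
        have hst : t < s := hθm.lt_iff_lt.1 (by rw [hθt]; exact h')
        exact hno t ⟨hxm.trans_le ht.1, hst.trans_le hs.2⟩ ((hBiff t).2 ⟨_, hθt⟩)
    refine ⟨foldedVelocity e w α φ k, norm_foldedVelocity he hw hew α φ k, fun s hs => ?_⟩
    rw [foldedLine_eq hα hp k (hall s hs), foldedLine_eq hα hp k (hall x ⟨le_rfl, hxy.le⟩)]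
    module
  · intro t ht hf
    by_contra h
    have h1 : foldedLine v e w α p φ t ∈ frontier (openCone v e α) :=
      hE ⟨hf, fun h2 => h (subset_closure h2)⟩
    rw [(isOpen_openCone he0 α).frontier_eq] at h1
    exact h1.2 (hnotB t ht)
  · intro t ht hf htE hfreq
    obtain ⟨k, hk, ρ, c, h1, h2, h3, h4, h5, h6, h7⟩ := hlocal t ht htE
    have hstr := h1.hasStrictFDerivAt' h3.hasFDerivAt one_ne_zero
    have hνpos : 0 < (InnerProductSpace.toDual ℝ (Euc n)
        (c • (-Real.sin (α / 2) • e + ((-1) ^ k * Real.cos (α / 2)) • w)))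
        (c • (-Real.sin (α / 2) • e + ((-1) ^ k * Real.cos (α / 2)) • w)) := by
      rw [InnerProductSpace.toDual_apply_apply, real_inner_self_eq_norm_sq, norm_smul, mul_pow,
        norm_smul_add_smul he hw hew, mul_pow]
      have hc : 0 < ‖c‖ := norm_pos_iff.2 h2
      have hk2 : ((-1 : ℝ) ^ k) ^ 2 = 1 := by
        rcases neg_one_zpow_eq_one_or k with h | h <;> simp [h]
      rw [hk2, one_mul, neg_sq, Real.sin_sq_add_cos_sq]
      positivity
    have htend : Tendsto (foldedLine v e w α p φ) (𝓝[≠] t) (𝓝 (foldedLine v e w α p φ t)) :=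
      hcont.continuousAt.tendsto.mono_left nhdsWithin_le_nhds
    have hfr : ∃ᶠ y in 𝓝 (foldedLine v e w α p φ t), 0 < ρ y ∧ y ∈ Ω :=
      htend.frequently ((hfreq.and_eventually h7).mono fun s hs => ⟨hs.2, hs.1⟩)
    have hev := eventually_mem_of_frequently_mem hΩ hstr hνpos h4 h5 hfr
    filter_upwards [htend.eventually hev, h7] with s hs hs'
    exact hs hs'
  · intro t ht hf htE
    obtain ⟨k, hk, ρ, c, h1, h2, h3, h4, h5, h6, h7⟩ := hlocal t ht htE
    have hk2 : ((-1 : ℝ) ^ k) ^ 2 = 1 := by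
      rcases neg_one_zpow_eq_one_or k with h | h <;> simp [h]
    have hν : ‖-Real.sin (α / 2) • e + ((-1) ^ k * Real.cos (α / 2)) • w‖ = 1 := by
      rw [← pow_eq_one_iff_of_nonneg (norm_nonneg _) two_ne_zero,
        norm_smul_add_smul he hw hew, mul_pow, hk2, one_mul, neg_sq, Real.sin_sq_add_cos_sq]
    refine ⟨_, foldedVelocity e w α φ k, foldedVelocity e w α φ (k + 1),
      isUnitNormal_frontier hΩ hν h1 h2 h3 h4 h5 h6 hf, foldedVelocity_succ he hw hew α φ k, ?_, ?_⟩
    · have h8 : ∀ᶠ s in 𝓝[<] t, k * α - α / 2 < θ s := nhdsWithin_le_nhds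
        (hθc.continuousAt.eventually (lt_mem_nhds (by rw [hk]; linarith)))
      filter_upwards [h8, self_mem_nhdsWithin] with s hs hs'
      have h9 : θ s < θ t := hθm hs'
      rw [foldedLine_eq hα hp k (t := s) (abs_le.2 ⟨by
        change _ ≤ θ s - _; linarith, by change θ s - _ ≤ _; linarith⟩),
        foldedLine_eq hα hp k (t := t) (abs_le.2 ⟨by
        change _ ≤ θ t - _; linarith, by change θ t - _ ≤ _; linarith⟩)]
      module
    · have h8 : ∀ᶠ s in 𝓝[>] t, θ s < (k + 1) * α + α / 2 := nhdsWithin_le_nhds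
        (hθc.continuousAt.eventually (gt_mem_nhds (by rw [hk]; linarith)))
      filter_upwards [h8, self_mem_nhdsWithin] with s hs hs'
      have h9 : θ t < θ s := hθm hs'
      rw [foldedLine_eq hα hp (k + 1) (t := s) (abs_le.2 ⟨by
        change _ ≤ θ s - _; push_cast; linarith, by change θ s - _ ≤ _; push_cast; linarith⟩),
        foldedLine_eq hα hp (k + 1) (t := t) (abs_le.2 ⟨by
        change _ ≤ θ t - _; push_cast; linarith, by change θ t - _ ≤ _; push_cast; linarith⟩)]
      module
  · obtain ⟨R, hR⟩ := hb.subset_closedBall v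
    refine ⟨R, fun t ht => ?_⟩
    have h1 := hR ht
    rw [mem_closedBall_iff_norm] at h1
    rw [foldedLine, norm_planePoint_sub he hw hew (hrpos t).le] at h1
    refine le_trans ?_ h1
    rw [← Real.sqrt_sq_eq_abs]
    exact Real.sqrt_le_sqrt (by nlinarith)

/-- A straight line that does not meet the boundary off the set of tomography is a reflected path
without kinks. -/
theorem isReflectedPath_straight (he : ‖e‖ = 1) (hw : ‖w‖ = 1) (hew : inner ℝ e w = 0)
    {Ω E : Set (Euc n)} (hb : Bornology.IsBounded Ω)
    (hE : ∀ r θ, 0 < r → planePoint v e w r θ ∈ frontier Ω → planePoint v e w r θ ∈ E)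
    {p : ℝ} (hp : 0 < p) (φ : ℝ) :
    IsReflectedPath Ω E
      (fun t => planePoint v e w (√(p ^ 2 + t ^ 2)) (φ + Real.arctan (t / p))) ∅ := by
  have hrpos : ∀ t : ℝ, 0 < √(p ^ 2 + t ^ 2) := fun t => Real.sqrt_pos.2 (by positivity)
  have hcont : Continuous fun t : ℝ =>
      planePoint v e w (√(p ^ 2 + t ^ 2)) (φ + Real.arctan (t / p)) :=
    continuous_planePoint (by fun_prop) (by have := Real.continuous_arctan; fun_prop)
  refine ⟨hcont, finite_empty, ?_, by simp, ?_, by simp, by simp, ?_⟩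
  · intro x y _ _
    refine ⟨-Real.sin φ • e + Real.cos φ • w, ?_, fun s _ => ?_⟩
    · rw [← pow_eq_one_iff_of_nonneg (norm_nonneg _) two_ne_zero,
        norm_smul_add_smul he hw hew, neg_sq, Real.sin_sq_add_cos_sq]
    · obtain ⟨h1, h2⟩ := sqrt_mul_cos_add_arctan hp s φ
      obtain ⟨h3, h4⟩ := sqrt_mul_cos_add_arctan hp x φ
      simp only [planePoint, smul_add, smul_smul, h1, h2, h3, h4]
      module
  · intro t _ h
    exact subset_closure (hE _ _ (hrpos t) h)
  · obtain ⟨R, hR⟩ := hb.subset_closedBall v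
    refine ⟨R, fun t ht => ?_⟩
    have h1 := hR ht
    rw [mem_closedBall_iff_norm] at h1
    rw [norm_planePoint_sub he hw hew (hrpos t).le] at h1
    refine le_trans ?_ h1
    rw [← Real.sqrt_sq_eq_abs]
    exact Real.sqrt_le_sqrt (by nlinarith)

end

/-! ### Vanishing on planes and on the whole space -/

section

variable {n : ℕ} {v e w : Euc n}

theorem measurable_planePoint {X : Type*} [MeasurableSpace X] {r θ : X → ℝ} (hr : Measurable r)
    (hθ : Measurable θ) : Measurable fun x => planePoint v e w (r x) (θ x) :=
  (continuous_planePoint (v := v) (e := e) (w := w) continuous_fst continuous_snd).measurable.comp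
    (hr.prodMk hθ)

/-- A function on a plane vanishes almost everywhere if its integrals over all lines off the vertex,
unfolded by a periodic function of the angle, vanish. -/
theorem ae_plane_eq_zero_of_line_integrals (he : ‖e‖ = 1) (hw : ‖w‖ = 1) (hew : inner ℝ e w = 0)
    {g : Euc n → ℝ} (hg : Measurable g) {M R : ℝ} (hR : 0 < R) (hM : ∀ x, |g x| ≤ M)
    (h0 : ∀ x, R < ‖x - v‖ → g x = 0) {fold : ℝ → ℝ} (hfold : Measurable fold) {T a : ℝ} (hT : 0 < T)
    (hper : ∀ r, Function.Periodic (fun θ => planePoint v e w r (fold θ)) T)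
    (hψ : ∀ r ψ, 0 < r → ψ ∈ Ioo (-Real.pi) Real.pi → g (planePoint v e w r ψ) ≠ 0 →
      ψ ∈ Ioc a (a + T) ∧ fold ψ = ψ)
    (hline : ∀ p φ : ℝ, 0 < p →
      ∫ t, g (planePoint v e w (√(p ^ 2 + t ^ 2)) (fold (φ + Real.arctan (t / p)))) = 0) :
    ∀ᵐ x : ℝ × ℝ, g (v + x.1 • e + x.2 • w) = 0 := by
  -- negative radii are cut off, as they would not be of bounded support
  let F : ℝ → ℝ → ℝ := fun r θ => if 0 < r then g (planePoint v e w r (fold θ)) else 0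
  have hFm : Measurable (Function.uncurry F) := by
    refine Measurable.ite (measurableSet_lt measurable_const measurable_fst) ?_ measurable_const
    exact hg.comp (measurable_planePoint measurable_fst (hfold.comp measurable_snd))
  have hM0 : 0 ≤ M := (abs_nonneg _).trans (hM 0)
  have key := ae_eq_zero_of_polar_line_integrals hT hFm hR (M := M) (fun r θ => by
      simp only [F]; split_ifs
      · exact hM _
      · simpa using hM0)
    (fun r θ hr => by
      have hr0 : 0 < r := hR.trans hr
      simp only [F, hr0, if_true]
      exact h0 _ (by rw [norm_planePoint_sub he hw hew hr0.le]; exact hr))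
    (fun r θ => by
      have h1 : planePoint v e w r (fold (θ + T)) = planePoint v e w r (fold θ) := hper r θ
      simp only [F, h1])
    (fun p φ hp => by
      rw [← hline p φ hp]
      refine integral_congr_ae (Eventually.of_forall fun t => ?_)
      have : 0 < √(p ^ 2 + t ^ 2) := Real.sqrt_pos.2 (by positivity)
      simp only [F, this, if_true]) a
  have hGm : Measurable fun x : ℝ × ℝ => g (v + x.1 • e + x.2 • w) := hg.comp (by fun_prop)
  have hpt : ∀ r θ : ℝ, v + (r * Real.cos θ) • e + (r * Real.sin θ) • w = planePoint v e w r θ := by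
    intro r θ
    rw [planePoint]; module
  have hl : ∫⁻ x : ℝ × ℝ, ‖g (v + x.1 • e + x.2 • w)‖ₑ = 0 := by
    rw [← lintegral_comp_polarCoord_symm, polarCoord_target, Measure.volume_eq_prod,
      ← Measure.prod_restrict, lintegral_prod]
    · rw [lintegral_eq_zero_iff']
      · filter_upwards [key, ae_restrict_mem measurableSet_Ioi] with r hr hr0
        have hr0' : 0 < r := hr0
        simp only [Pi.zero_apply]
        rw [lintegral_eq_zero_iff']
        · rw [ae_restrict_iff' measurableSet_Ioc] at hr
          filter_upwards [ae_restrict_of_ae hr, ae_restrict_mem measurableSet_Ioo] with ψ h1 h2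
          simp only [polarCoord_symm_apply, Pi.zero_apply, smul_eq_mul]
          rw [hpt]
          -- Where `g` is nonzero the angle lies in the chosen period and is fixed by the folding,
          -- so `F` is `g` there.
          by_cases h3 : g (planePoint v e w r ψ) = 0
          · rw [h3]; simp
          · obtain ⟨h4, h5⟩ := hψ r ψ hr0' h2 h3
            have h6 := h1 h4
            simp only [F, hr0', if_true, h5] at h6
            exact absurd h6 h3
        · refine Measurable.aemeasurable ?_
          simp only [polarCoord_symm_apply]
          have h7 : Measurable fun y : ℝ => g (v + (r * Real.cos y) • e + (r * Real.sin y) • w) :=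
            hg.comp (by fun_prop)
          exact measurable_const.mul h7.enorm
      · refine Measurable.aemeasurable ?_
        refine Measurable.lintegral_prod_right' (f := fun x : ℝ × ℝ => ENNReal.ofReal x.1 •
          ‖g (v + (polarCoord.symm x).1 • e + (polarCoord.symm x).2 • w)‖ₑ) ?_
        simp only [polarCoord_symm_apply, smul_eq_mul]
        have h7 : Measurable fun x : ℝ × ℝ =>
            g (v + (x.1 * Real.cos x.2) • e + (x.1 * Real.sin x.2) • w) := hg.comp (by fun_prop)
        exact (ENNReal.measurable_ofReal.comp measurable_fst).mul h7.enorm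
    · refine Measurable.aemeasurable ?_
      simp only [polarCoord_symm_apply, smul_eq_mul]
      have h7 : Measurable fun x : ℝ × ℝ =>
          g (v + (x.1 * Real.cos x.2) • e + (x.1 * Real.sin x.2) • w) := hg.comp (by fun_prop)
      exact (ENNReal.measurable_ofReal.comp measurable_fst).mul h7.enorm
  rw [lintegral_eq_zero_iff hGm.enorm] at hl
  filter_upwards [hl] with x hx
  simpa using hx

theorem exists_orthogonal_decomposition (he : ‖e‖ = 1) {y : Euc n}
    (hy : y ∉ Submodule.span ℝ {e}) :
    ∃ (w : Euc n) (a b : ℝ), ‖w‖ = 1 ∧ inner ℝ e w = 0 ∧ b ≠ 0 ∧ y = a • e + b • w := by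
  let z := y - inner ℝ e y • e
  have hz : z ≠ 0 := by
    intro h
    refine hy (Submodule.mem_span_singleton.2 ⟨inner ℝ e y, ?_⟩)
    exact (sub_eq_zero.1 h).symm
  have hz' : ‖z‖ ≠ 0 := norm_ne_zero_iff.2 hz
  refine ⟨‖z‖⁻¹ • z, inner ℝ e y, ‖z‖, ?_, ?_, hz', ?_⟩
  · rw [norm_smul, norm_inv, norm_norm, inv_mul_cancel₀ hz']
  · rw [inner_smul_right]
    simp [z, inner_sub_right, inner_smul_right, he]
  · rw [smul_smul, mul_inv_cancel₀ hz', one_smul]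
    simp [z]

/-- Used to pass from an orthonormal frame `e, w` to `e, a • e + b • w`. The change of coordinates
is linear and invertible, so it preserves null sets. -/
theorem ae_shear {P : ℝ × ℝ → Prop} (h : ∀ᵐ x, P x) (a : ℝ) {b : ℝ} (hb : b ≠ 0) :
    ∀ᵐ x : ℝ × ℝ, P (x.1 + x.2 * a, x.2 * b) := by
  let L : (ℝ × ℝ) ≃ₗ[ℝ] (ℝ × ℝ) :=
    { toFun := fun x => (x.1 + x.2 * a, x.2 * b)
      invFun := fun x => (x.1 - x.2 / b * a, x.2 / b)
      map_add' := fun x y => by ext <;> simp <;> ring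
      map_smul' := fun c x => by ext <;> simp <;> ring
      left_inv := fun x => by ext <;> simp [hb]
      right_inv := fun x => by ext <;> simp [hb] }
  exact (Measure.LinearMap.quasiMeasurePreserving volume (L : (ℝ × ℝ) →ₗ[ℝ] (ℝ × ℝ))
    L.isUnit_det'.ne_zero).ae h

/-- A function vanishes almost everywhere if it vanishes almost everywhere on almost all planes
through a given line. -/
theorem ae_eq_zero_of_planes {g : Euc n → ℝ} (hg : Measurable g)
    (h : ∀ᵐ y : Euc n, ∀ᵐ x : ℝ × ℝ, g (v + x.1 • e + x.2 • y) = 0) : ∀ᵐ x, g x = 0 := by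
  have hm : Measurable fun z : Euc n × (ℝ × ℝ) => g (v + z.2.1 • e + z.2.2 • z.1) :=
    hg.comp (by fun_prop)
  rw [Measure.ae_ae_comm (p := fun (y : Euc n) (x : ℝ × ℝ) => g (v + x.1 • e + x.2 • y) = 0)
    (hm (measurableSet_singleton 0))] at h
  rw [Measure.volume_eq_prod] at h
  have h1 := Measure.ae_ae_of_ae_prod h
  -- After Fubini a single pair `(t, s)` with `s ≠ 0` suffices: `y ↦ v + t • e + s • y` is then an
  -- affine bijection of the whole space.
  obtain ⟨t, ht⟩ := h1.exists
  have hne : ∀ᵐ s : ℝ, s ≠ 0 := by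
    rw [ae_iff]; simp
  obtain ⟨s, hs, hs0⟩ := (ht.and hne).exists
  have hq : Measure.QuasiMeasurePreserving (fun x : Euc n => s⁻¹ • (x - (v + t • e))) volume volume :=
    (Measure.quasiMeasurePreserving_smul volume (inv_ne_zero hs0)).comp
      (measurePreserving_sub_right volume (v + t • e)).quasiMeasurePreserving
  filter_upwards [hq.ae hs] with x hx
  rwa [smul_smul, mul_inv_cancel₀ hs0, one_smul, add_sub_cancel] at hx

theorem ae_notMem_span_of_card_lt {s : Finset (Euc n)} (hs : s.card < n) :
    ∀ᵐ y : Euc n, y ∉ Submodule.span ℝ (s : Set (Euc n)) := by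
  have hne : Submodule.span ℝ (s : Set (Euc n)) ≠ ⊤ := by
    intro h
    have h1 := finrank_span_finset_le_card (R := ℝ) s
    rw [Set.finrank, h, finrank_top, finrank_euclideanSpace_fin] at h1
    omega
  exact measure_eq_zero_iff_ae_notMem.1 (Measure.addHaar_submodule volume _ hne)

theorem exists_unit_orthogonal (hn : 2 ≤ n) (e : Euc n) :
    ∃ d : Euc n, ‖d‖ = 1 ∧ inner ℝ e d = 0 := by
  have hne : (Submodule.span ℝ {e})ᗮ ≠ ⊥ := by
    intro h
    rw [Submodule.orthogonal_eq_bot_iff] at h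
    have h1 := finrank_span_le_card (R := ℝ) ({e} : Set (Euc n))
    rw [h, finrank_top, finrank_euclideanSpace_fin] at h1
    simp at h1
    omega
  obtain ⟨z, hz, hz0⟩ := Submodule.exists_mem_ne_zero_of_ne_bot hne
  refine ⟨‖z‖⁻¹ • z, ?_, ?_⟩
  · rw [norm_smul, norm_inv, norm_norm, inv_mul_cancel₀ (norm_ne_zero_iff.2 hz0)]
  · rw [inner_smul_right, Submodule.mem_orthogonal_singleton_iff_inner_right.1 hz, mul_zero]

theorem openCone_smul {u : Euc n} {c : ℝ} (hc : 0 < c) (α : ℝ) :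
    openCone v (c • u) α = openCone v u α := by
  ext x
  change _ ∧ _ ↔ _ ∧ _
  rw [InnerProductGeometry.angle_smul_right_of_pos _ _ hc]

/-- Planes through the axis serve whenever the cone has a boundary hypersurface, that is, for `α <
2π` or in dimension two. Otherwise planes that avoid the removed half-line off the vertex are used,
and no unfolding is needed. -/
theorem ae_eq_zero_of_sameBrt (hn : 2 ≤ n) {u : Euc n} (hu : u ≠ 0) {α : ℝ} (hα : 0 < α)
    (hα2 : α ≤ 2 * Real.pi) {Ω E : Set (Euc n)} (hΩ : IsOpen Ω) (hb : Bornology.IsBounded Ω)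
    (hC : Ω ⊆ openCone v u α) (hE : frontier Ω \ E ⊆ frontier (openCone v u α))
    {f₁ f₂ g₁ g₂ : Euc n → ℝ} (hg₁ : Measurable g₁) (hg₂ : Measurable g₂) {M : ℝ}
    (hM₁ : ∀ x, |g₁ x| ≤ M) (hM₂ : ∀ x, |g₂ x| ≤ M) (hf₁ : EqOn f₁ g₁ (closure Ω))
    (hf₂ : EqOn f₂ g₂ (closure Ω)) (hsame : SameBrt Ω E f₁ f₂) :
    ∀ᵐ x, Ω.indicator (fun x => g₁ x - g₂ x) x = 0 := by
  have hpi := Real.pi_pos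
  obtain ⟨e, he, hcone⟩ : ∃ e : Euc n, ‖e‖ = 1 ∧ openCone v e α = openCone v u α := by
    have hu' : 0 < ‖u‖ := norm_pos_iff.2 hu
    exact ⟨‖u‖⁻¹ • u, by rw [norm_smul, norm_inv, norm_norm, inv_mul_cancel₀ hu'.ne'],
      openCone_smul (by positivity) α⟩
  rw [← hcone] at hC hE
  have he0 : e ≠ 0 := by rintro rfl; simp at he
  obtain ⟨R₀, hR₀⟩ := hb.subset_closedBall v
  let R := max R₀ 1
  have hR : 0 < R := lt_of_lt_of_le one_pos (le_max_right _ _)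
  have hDm : Measurable (Ω.indicator fun x => g₁ x - g₂ x) :=
    (hg₁.sub hg₂).indicator hΩ.measurableSet
  have hM0 : 0 ≤ M := (abs_nonneg _).trans (hM₁ 0)
  have hDM : ∀ x, |Ω.indicator (fun x => g₁ x - g₂ x) x| ≤ 2 * M := by
    intro x
    by_cases h : x ∈ Ω
    · rw [indicator_of_mem h]
      have := abs_sub (g₁ x) (g₂ x)
      linarith [hM₁ x, hM₂ x]
    · rw [indicator_of_notMem h, abs_zero]; positivity
  have hD0 : ∀ x, R < ‖x - v‖ → Ω.indicator (fun x => g₁ x - g₂ x) x = 0 := by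
    intro x hx
    refine indicator_of_notMem (fun h => ?_) _
    have := hR₀ h
    rw [mem_closedBall_iff_norm] at this
    exact absurd (this.trans (le_max_left _ _)) (not_le.2 hx)
  by_cases hcase : α < 2 * Real.pi ∨ n = 2
  · refine ae_eq_zero_of_planes (v := v) (e := e) hDm ?_
    have hsp := ae_notMem_span_of_card_lt (s := {e}) (by simp; omega)
    filter_upwards [hsp] with y hy
    obtain ⟨w, a, b, hw, hew, hb0, rfl⟩ := exists_orthogonal_decomposition he (by simpa using hy)
    -- The period `(-α, α]` contains the sector `|ψ| < α / 2`, on which folding is the identity.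
    have hpl := ae_plane_eq_zero_of_line_integrals (v := v) he hw hew hDm hR hDM hD0
      (continuous_foldAngle α).measurable (T := 2 * α) (a := -α) (by positivity)
      (fun r θ => by simp only [periodic_foldAngle hα θ]) (fun r ψ hr hψ hne => by
        have hmem : planePoint v e w r ψ ∈ Ω := by
          by_contra h
          exact hne (indicator_of_notMem h _)
        have h1 := (planePoint_mem_openCone_iff he hw hew hr (abs_le.2 ⟨hψ.1.le, hψ.2.le⟩)).1
          (hC hmem)
        have h2 := abs_lt.1 h1
        refine ⟨⟨by linarith, by linarith⟩, ?_⟩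
        have := foldAngle_eq hα (θ := ψ) 0 (by simpa using h1.le)
        simpa using this)
      (fun p φ hp => (isReflectedPath_foldedLine he hw hew hα hα2 hcase hΩ hb hC hE
        hp φ).integral_eq_zero hΩ hg₁ hg₂ hM₁ hM₂ hf₁ hf₂ hsame)
    filter_upwards [ae_shear hpl a hb0] with x hx
    rw [← hx]
    congr 1
    module
  · obtain ⟨hα', hn'⟩ := not_or.1 hcase
    have hαeq : α / 2 = Real.pi := by
      have := le_antisymm hα2 (not_lt.1 hα'); linarith
    obtain ⟨d, hd, hed⟩ := exists_unit_orthogonal hn e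
    refine ae_eq_zero_of_planes (v := v) (e := d) hDm ?_
    classical
    have hsp := ae_notMem_span_of_card_lt (s := {d, e})
      (lt_of_le_of_lt Finset.card_le_two (by omega))
    filter_upwards [hsp] with y hy
    have hyd : y ∉ Submodule.span ℝ {d} := fun h => hy (Submodule.span_mono (by simp) h)
    obtain ⟨w, a, b, hw, hdw, hb0, rfl⟩ := exists_orthogonal_decomposition hd hyd
    -- A reflecting point other than `v` is `v + c • e` with `c < 0`. If it were in the plane,
    -- orthogonality of `d` and `e` would make `w` a multiple of `e`, which contradicts the choice
    -- of `y`.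
    have hfr : ∀ r θ, 0 < r → planePoint v d w r θ ∈ frontier Ω → planePoint v d w r θ ∈ E := by
      intro r θ hr hf
      by_contra hnE
      rcases angle_eq_of_mem_frontier_openCone he0 (hE ⟨hf, hnE⟩) with h | h
      · have := norm_planePoint_sub (v := v) hd hw hdw hr.le θ
        rw [h, sub_self, norm_zero] at this
        exact hr.ne this
      · rw [hαeq] at h
        obtain ⟨-, c, hc, hceq⟩ := InnerProductGeometry.angle_eq_pi_iff.1
          ((InnerProductGeometry.angle_comm _ _).trans h)
        have hsum : (r * Real.cos θ) • d + (r * Real.sin θ) • w = c • e := by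
          rw [← hceq, planePoint]; module
        have hcosz : r * Real.cos θ = 0 := by
          have h2 := congrArg (fun z => inner ℝ d z) hsum
          simp only [inner_add_right, inner_smul_right, hdw, real_inner_self_eq_norm_sq, hd] at h2
          rw [real_inner_comm, hed] at h2
          simpa using h2
        rw [hcosz, zero_smul, zero_add] at hsum
        have hsz : r * Real.sin θ ≠ 0 := by
          intro h3
          rw [h3, zero_smul] at hsum
          exact (smul_ne_zero hc.ne he0) hsum.symm
        have hwe : w = ((r * Real.sin θ)⁻¹ * c) • e := by
          rw [mul_smul, ← hsum, smul_smul, inv_mul_cancel₀ hsz, one_smul]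
        apply hy
        rw [hwe, smul_smul]
        exact Submodule.add_mem _ (Submodule.smul_mem _ _ (Submodule.subset_span (by simp)))
          (Submodule.smul_mem _ _ (Submodule.subset_span (by simp)))
    have hpl := ae_plane_eq_zero_of_line_integrals (v := v) hd hw hdw hDm hR hDM hD0
      measurable_id (T := 2 * Real.pi) (a := -Real.pi) (by positivity)
      (fun r θ => by simp only [id, planePoint, Real.cos_add_two_pi, Real.sin_add_two_pi])
      (fun r ψ _ hψ _ => ⟨⟨hψ.1, by linarith [hψ.2]⟩, rfl⟩)
      (fun p φ hp => (isReflectedPath_straight hd hw hdw hb hfr hp φ).integral_eq_zero hΩ hg₁ hg₂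
        hM₁ hM₂ hf₁ hf₂ hsame)
    filter_upwards [ae_shear hpl a hb0] with x hx
    rw [← hx]
    congr 1
    module

/-- Cutting off to `closure Ω` gives globally measurable bounded functions without changing any
broken ray integral. Equality almost everywhere holds on a dense subset of Ω, so it extends to
common points of continuity. -/
theorem ae_eq_and_eq_of_sameBrt (hn : 2 ≤ n) {u : Euc n} (hu : u ≠ 0) {α : ℝ} (hα : 0 < α)
    (hα2 : α ≤ 2 * Real.pi) {Ω E : Set (Euc n)} (hΩ : IsOpen Ω) (hb : Bornology.IsBounded Ω)
    (hC : Ω ⊆ openCone v u α) (hE : frontier Ω \ E ⊆ frontier (openCone v u α))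
    {f₁ f₂ : Euc n → ℝ} (hf₁ : Measurable ((closure Ω).domRestrict f₁))
    (hf₂ : Measurable ((closure Ω).domRestrict f₂)) {M₁ M₂ : ℝ} (hM₁ : ∀ x ∈ closure Ω, |f₁ x| ≤ M₁)
    (hM₂ : ∀ x ∈ closure Ω, |f₂ x| ≤ M₂) (hsame : SameBrt Ω E f₁ f₂) :
    f₁ =ᵐ[volume.restrict Ω] f₂ ∧
      ∀ x ∈ closure Ω, ContinuousWithinAt f₁ (closure Ω) x → ContinuousWithinAt f₂ (closure Ω) x →
        f₁ x = f₂ x := by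
  have hind : ∀ f : Euc n → ℝ, Measurable ((closure Ω).domRestrict f) →
      Measurable ((closure Ω).indicator f) := by
    intro f hf
    refine measurable_of_restrict_of_restrict_compl (s := closure Ω)
      isClosed_closure.measurableSet ?_ ?_
    · have h1 : (closure Ω).domRestrict ((closure Ω).indicator f) = (closure Ω).domRestrict f :=
        funext fun x => indicator_of_mem x.2 f
      rwa [h1]
    · have h1 : (closure Ω)ᶜ.domRestrict ((closure Ω).indicator f) = fun _ => 0 :=
        funext fun x => indicator_of_notMem x.2 f
      rw [h1]; exact measurable_const
  have hbd : ∀ (f : Euc n → ℝ) (M : ℝ), (∀ x ∈ closure Ω, |f x| ≤ M) → M ≤ max (max M₁ M₂) 0 →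
      ∀ x, |(closure Ω).indicator f x| ≤ max (max M₁ M₂) 0 := by
    intro f M hf hM x
    by_cases hx : x ∈ closure Ω
    · rw [indicator_of_mem hx]; exact (hf x hx).trans hM
    · rw [indicator_of_notMem hx, abs_zero]; exact le_max_right _ _
  have hae := ae_eq_zero_of_sameBrt hn hu hα hα2 hΩ hb hC hE (hind f₁ hf₁) (hind f₂ hf₂)
    (hbd f₁ M₁ hM₁ ((le_max_left _ _).trans (le_max_left _ _)))
    (hbd f₂ M₂ hM₂ ((le_max_right _ _).trans (le_max_left _ _)))
    (fun x hx => (indicator_of_mem hx f₁).symm) (fun x hx => (indicator_of_mem hx f₂).symm) hsame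
  have hae' : ∀ᵐ x, x ∈ Ω → f₁ x = f₂ x := by
    filter_upwards [hae] with x hx hxΩ
    rw [indicator_of_mem hxΩ, indicator_of_mem (subset_closure hxΩ),
      indicator_of_mem (subset_closure hxΩ)] at hx
    exact sub_eq_zero.1 hx
  refine ⟨(ae_restrict_iff' hΩ.measurableSet).2 hae', fun x hx h₁ h₂ => ?_⟩
  have hdense : x ∈ closure (Ω ∩ {y | y ∈ Ω → f₁ y = f₂ y}) := by
    have : Dense {y | y ∈ Ω → f₁ y = f₂ y} := Measure.dense_of_ae hae'
    exact this.open_subset_closure_inter hΩ |> fun h => closure_minimal h isClosed_closure hx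
  have hne : (𝓝[Ω ∩ {y | y ∈ Ω → f₁ y = f₂ y}] x).NeBot := mem_closure_iff_nhdsWithin_neBot.1 hdense
  have hsub : Ω ∩ {y | y ∈ Ω → f₁ y = f₂ y} ⊆ closure Ω := fun y hy => subset_closure hy.1
  refine tendsto_nhds_unique_of_eventuallyEq (h₁.mono hsub) (h₂.mono hsub) ?_
  filter_upwards [self_mem_nhdsWithin] with y hy
  exact hy.2 hy.1

/-- The broken ray transform is injective on bounded open subsets of a cone whose reflecting
boundary lies on the cone. -/
theorem brtInjective_of_subset_openCone (hn : 2 ≤ n) {u : Euc n} (hu : u ≠ 0) {α : ℝ} (hα : 0 < α)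
    (hα2 : α ≤ 2 * Real.pi) {Ω E : Set (Euc n)} (hΩ : IsOpen Ω) (hb : Bornology.IsBounded Ω)
    (hC : Ω ⊆ openCone v u α) (hE : frontier Ω \ E ⊆ frontier (openCone v u α)) :
    BrtInjective Ω E := by
  constructor
  · rintro f₁ f₂ ⟨-, hm₁, M₁, hM₁⟩ ⟨-, hm₂, M₂, hM₂⟩ hsame
    exact ae_eq_and_eq_of_sameBrt hn hu hα hα2 hΩ hb hC hE hm₁ hm₂ hM₁ hM₂ hsame
  · intro f₁ f₂ hf₁ hf₂ hsame x hx
    obtain ⟨M₁, hM₁⟩ := hb.isCompact_closure.exists_bound_of_continuousOn hf₁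
    obtain ⟨M₂, hM₂⟩ := hb.isCompact_closure.exists_bound_of_continuousOn hf₂
    exact (ae_eq_and_eq_of_sameBrt hn hu hα hα2 hΩ hb hC hE
      (continuousOn_iff_continuous_domRestrict.1 hf₁).measurable
      (continuousOn_iff_continuous_domRestrict.1 hf₂).measurable hM₁ hM₂ hsame).2 x hx
      (hf₁ x hx) (hf₂ x hx)

/-- The condition on the boundary is inherited: the reflecting part of the boundary of Ω' is
contained in that of Ω, hence lies on the same cone. -/
theorem brtInjectiveWithSubdomains_of_subset_openCone (hn : 2 ≤ n) {u : Euc n} (hu : u ≠ 0) {α : ℝ}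
    (hα : 0 < α) (hα2 : α ≤ 2 * Real.pi) {Ω E : Set (Euc n)} (hΩ : IsOpen Ω)
    (hb : Bornology.IsBounded Ω) (hC : Ω ⊆ openCone v u α)
    (hE : frontier Ω \ E ⊆ frontier (openCone v u α)) : BrtInjectiveWithSubdomains Ω E := by
  refine ⟨brtInjective_of_subset_openCone hn hu hα hα2 hΩ hb hC hE, fun Ω' hΩ' _ hsub => ?_⟩
  refine brtInjective_of_subset_openCone hn hu hα hα2 hΩ' (hb.subset hsub) (hsub.trans hC) ?_
  rintro x ⟨hx, hx'⟩
  apply hE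
  by_contra h
  exact hx' ⟨hx, h⟩

end

/-! ### Radial and polar domains -/

theorem isOpen_sep_norm_lt {n : ℕ} {C : Set (Euc n)} (hC : IsOpen C) {G : Euc n → ℝ}
    (hG : ContinuousOn G C) : IsOpen {x | x ∈ C ∧ ‖x‖ < G x} := by
  rw [isOpen_iff_mem_nhds]
  rintro x ⟨hx, hxG⟩
  have h1 : ContinuousAt (fun y => G y - ‖y‖) x :=
    (hG.continuousAt (hC.mem_nhds hx)).sub continuous_norm.continuousAt
  filter_upwards [hC.mem_nhds hx, h1.eventually (lt_mem_nhds (sub_pos.2 hxG))] with y hy hy'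
  exact ⟨hy, sub_pos.1 hy'⟩

/-- At a frontier point inside `C`, continuity of `G` forces equality of `‖x‖` and `G x`. -/
theorem frontier_sep_norm_lt_diff_subset {n : ℕ} {C : Set (Euc n)} (hC : IsOpen C) {G : Euc n → ℝ}
    (hG : ContinuousOn G C) :
    frontier {x | x ∈ C ∧ ‖x‖ < G x} \ {x | x ∈ C ∧ ‖x‖ = G x} ⊆ frontier C := by
  rintro x ⟨hx, hxE⟩
  rw [(isOpen_sep_norm_lt hC hG).frontier_eq] at hx
  have hcl : x ∈ closure C := closure_mono (fun y hy => hy.1) hx.1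
  rw [hC.frontier_eq]
  refine ⟨hcl, fun hxC => hxE ⟨hxC, le_antisymm ?_ ?_⟩⟩
  · have h1 : ContinuousAt (fun y => ‖y‖ - G y) x :=
      continuous_norm.continuousAt.sub (hG.continuousAt (hC.mem_nhds hxC))
    by_contra h
    have h2 := h1.eventually (lt_mem_nhds (sub_pos.2 (not_le.1 h)))
    obtain ⟨y, hy, hy'⟩ := ((mem_closure_iff_frequently.1 hx.1).and_eventually h2).exists
    exact absurd hy.2 (not_lt.2 (sub_pos.1 hy').le)
  · by_contra h
    exact hx.2 ⟨hxC, not_le.1 h⟩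

theorem brtInjectiveWithSubdomains_radialDomain {n : ℕ} (hn : 2 ≤ n) {u : Euc n} (hu : u ≠ 0)
    {α : ℝ} (hα : 0 < α) (hα2 : α ≤ 2 * Real.pi) {h : Euc n → ℝ}
    (hh : ContinuousOn h (Metric.sphere 0 1)) :
    BrtInjectiveWithSubdomains (radialDomain (openCone 0 u α) h)
      (radialGraph (openCone 0 u α) h) := by
  have hC := isOpen_openCone (v := (0 : Euc n)) hu α
  have hpos : ∀ x ∈ openCone (0 : Euc n) u α, 0 < ‖x‖ := fun x hx => norm_pos_iff.2 hx.1
  have hD : radialDomain (openCone 0 u α) h =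
      {x | x ∈ openCone 0 u α ∧ ‖x‖ < h (‖x‖⁻¹ • x)} := by
    ext x
    exact ⟨fun hx => ⟨hx.1, hx.2.2⟩, fun hx => ⟨hx.1, hpos x hx.1, hx.2⟩⟩
  have hE : radialGraph (openCone 0 u α) h =
      {x | x ∈ openCone 0 u α ∧ ‖x‖ = h (‖x‖⁻¹ • x)} := by
    ext x
    exact ⟨fun hx => ⟨hx.1, hx.2.2⟩, fun hx => ⟨hx.1, hpos x hx.1, hx.2⟩⟩
  have hsph : ∀ x : Euc n, 0 < ‖x‖ → ‖x‖⁻¹ • x ∈ Metric.sphere (0 : Euc n) 1 := by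
    intro x hx
    rw [mem_sphere_zero_iff_norm, norm_smul, norm_inv, norm_norm, inv_mul_cancel₀ hx.ne']
  have hG : ContinuousOn (fun x => h (‖x‖⁻¹ • x)) (openCone 0 u α) := by
    refine hh.comp ?_ fun x hx => hsph x (hpos x hx)
    exact (continuous_norm.continuousOn.inv₀ fun x hx => (hpos x hx).ne').smul continuousOn_id
  obtain ⟨M, hM⟩ := (isCompact_sphere (0 : Euc n) 1).exists_bound_of_continuousOn hh
  rw [hD, hE]
  refine brtInjectiveWithSubdomains_of_subset_openCone (v := 0) hn hu hα hα2
    (isOpen_sep_norm_lt hC hG) ?_ (fun x hx => hx.1) (frontier_sep_norm_lt_diff_subset hC hG)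
  refine (Metric.isBounded_closedBall (x := (0 : Euc n)) (r := M)).subset fun x hx => ?_
  rw [mem_closedBall_zero_iff]
  exact hx.2.le.trans ((le_abs_self _).trans (hM _ (hsph x (hpos x hx.1))))

/-- Since `cos (arctan k) = 1 / √(1 + k²)`, both conditions compare `A² + z²` with `(1 + k²) z²` for
`z > 0`. The sign `s` covers slopes of either sign, as a negative slope turns the axis around. -/
theorem setOf_norm_lt_eq_openCone (d : ℕ) {k : ℝ} (hk : 0 < k) {s : ℝ} (hs : s = 1 ∨ s = -1) :
    {x : Euc (d + 1) | ‖(WithLp.toLp 2 (fun i : Fin d => x i.castSucc) : Euc d)‖ <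
      k * (s * x (Fin.last d))} =
    openCone 0 (s • EuclideanSpace.single (Fin.last d) (1 : ℝ)) (2 * Real.arctan k) := by
  have hpi := Real.pi_pos
  ext x
  have hnorm : ‖x‖ ^ 2 = ‖(WithLp.toLp 2 (fun i : Fin d => x i.castSucc) : Euc d)‖ ^ 2 +
      x (Fin.last d) ^ 2 := by
    rw [EuclideanSpace.norm_sq_eq, EuclideanSpace.norm_sq_eq, Fin.sum_univ_castSucc]
    simp
  have hinner : inner ℝ (x - 0) (s • EuclideanSpace.single (Fin.last d) (1 : ℝ)) =
      s * x (Fin.last d) := by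
    rw [sub_zero, inner_smul_right, EuclideanSpace.inner_single_right]
    simp
  have hun : ‖s • EuclideanSpace.single (Fin.last d) (1 : ℝ)‖ = 1 := by
    rw [norm_smul]
    rcases hs with rfl | rfl <;> simp
  have hss : s ^ 2 = 1 := by rcases hs with rfl | rfl <;> norm_num
  have hz2 : x (Fin.last d) ^ 2 = (s * x (Fin.last d)) ^ 2 := by rw [mul_pow, hss, one_mul]
  rw [hz2] at hnorm
  set z := s * x (Fin.last d)
  set A := ‖(WithLp.toLp 2 (fun i : Fin d => x i.castSucc) : Euc d)‖ with hA
  have hA0 : 0 ≤ A := norm_nonneg _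
  change A < k * z ↔ x ≠ 0 ∧ InnerProductGeometry.angle (x - 0) _ < 2 * Real.arctan k / 2
  rw [mul_div_cancel_left₀ _ (two_ne_zero' ℝ)]
  have hak : 0 < Real.arctan k := Real.arctan_pos.2 hk
  have hak2 := Real.arctan_lt_pi_div_two k
  have hq : 0 < √(1 + k ^ 2) := Real.sqrt_pos.2 (by positivity)
  have hq2 : √(1 + k ^ 2) ^ 2 = 1 + k ^ 2 := Real.sq_sqrt (by positivity)
  have hangle : ∀ hx : x ≠ 0, (InnerProductGeometry.angle (x - 0)
      (s • EuclideanSpace.single (Fin.last d) (1 : ℝ)) < Real.arctan k ↔ ‖x‖ < z * √(1 + k ^ 2)) := by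
    intro hx
    have hx' : 0 < ‖x‖ := norm_pos_iff.2 hx
    rw [← Real.strictAntiOn_cos.lt_iff_gt ⟨hak.le, by linarith⟩
      ⟨InnerProductGeometry.angle_nonneg _ _, InnerProductGeometry.angle_le_pi _ _⟩,
      InnerProductGeometry.cos_angle, hinner, hun, Real.cos_arctan, sub_zero, mul_one,
      div_lt_div_iff₀ hq hx', one_mul]
  constructor
  · intro h
    have hz : 0 < z := by
      by_contra h'
      have := mul_nonpos_of_nonneg_of_nonpos hk.le (not_lt.1 h')
      linarith
    have hx : x ≠ 0 := by
      rintro rfl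
      simp [z] at hz
    refine ⟨hx, (hangle hx).2 ?_⟩
    refine lt_of_pow_lt_pow_left₀ 2 (by positivity) ?_
    rw [mul_pow, hq2, hnorm]
    have : A ^ 2 < (k * z) ^ 2 := pow_lt_pow_left₀ h hA0 two_ne_zero
    nlinarith
  · rintro ⟨hx, h⟩
    have h1 := (hangle hx).1 h
    have hx' : 0 < ‖x‖ := norm_pos_iff.2 hx
    have hz : 0 < z := by
      by_contra h'
      have := mul_nonpos_of_nonpos_of_nonneg (not_lt.1 h') hq.le
      linarith
    refine lt_of_pow_lt_pow_left₀ 2 (by positivity) ?_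
    have h2 := pow_lt_pow_left₀ h1 hx'.le two_ne_zero
    rw [mul_pow, hq2, hnorm] at h2
    nlinarith

theorem slopeCone_eq_openCone (d : ℕ) {k : ℝ} (hk : k ≠ 0) :
    ∃ (u : Euc (d + 1)) (α : ℝ), u ≠ 0 ∧ 0 < α ∧ α ≤ 2 * Real.pi ∧
      slopeCone d k = openCone 0 u α := by
  have hne : EuclideanSpace.single (Fin.last d) (1 : ℝ) ≠ 0 := by
    rw [← norm_ne_zero_iff]; simp
  have hpi := Real.pi_pos
  rcases lt_or_gt_of_ne hk with h | h
  · have h' : 0 < -k := by linarith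
    refine ⟨(-1 : ℝ) • EuclideanSpace.single (Fin.last d) (1 : ℝ), 2 * Real.arctan (-k),
      smul_ne_zero (by norm_num) hne, mul_pos two_pos (Real.arctan_pos.2 h'), ?_, ?_⟩
    · linarith [Real.arctan_lt_pi_div_two (-k)]
    · rw [← setOf_norm_lt_eq_openCone d h' (Or.inr rfl), slopeCone]
      simp
  · refine ⟨(1 : ℝ) • EuclideanSpace.single (Fin.last d) (1 : ℝ), 2 * Real.arctan k,
      smul_ne_zero (by norm_num) hne, mul_pos two_pos (Real.arctan_pos.2 h), ?_, ?_⟩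
    · linarith [Real.arctan_lt_pi_div_two k]
    · rw [← setOf_norm_lt_eq_openCone d h (Or.inl rfl), slopeCone]
      simp

theorem brtInjectiveWithSubdomains_slopeCone {d : ℕ} (hd : 1 ≤ d) (k : ℝ) {h : Euc (d + 1) → ℝ}
    (hh : ContinuousOn h (Metric.sphere 0 1)) :
    BrtInjectiveWithSubdomains (radialDomain (slopeCone d k) h)
      (radialGraph (slopeCone d k) h) := by
  by_cases hk : k = 0
  · have hempty : radialDomain (slopeCone d k) h = ∅ := by
      refine eq_empty_of_forall_notMem fun x hx => ?_
      have h1 : _ < k * x (Fin.last d) := hx.1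
      rw [hk, zero_mul] at h1
      exact absurd h1 (not_lt.2 (norm_nonneg _))
    rw [hempty]
    -- Any cone contains the empty domain; a half-space is used.
    refine brtInjectiveWithSubdomains_of_subset_openCone (v := 0) (n := d + 1) (by omega)
      (u := EuclideanSpace.single (Fin.last d) (1 : ℝ)) (by rw [← norm_ne_zero_iff]; simp)
      Real.pi_pos (by linarith [Real.pi_pos]) isOpen_empty Bornology.isBounded_empty
      (empty_subset _) (by simp)
  · obtain ⟨u, α, hu, hα, hα2, heq⟩ := slopeCone_eq_openCone d hk
    rw [heq]
    exact brtInjectiveWithSubdomains_radialDomain (by omega) hu hα hα2 hh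

/-- Change of frame to the one rotated by β. With `β = α / 2` the sector `0 < θ < α` becomes
symmetric about its axis. -/
theorem polarPoint_add (r β ψ : ℝ) : polarPoint r (ψ + β) =
    planePoint 0 (polarPoint 1 β) (polarPoint 1 (β + Real.pi / 2)) r ψ := by
  ext i
  fin_cases i
  · simp [polarPoint, planePoint, Real.cos_add]; ring
  · simp [polarPoint, planePoint, Real.sin_add, Real.cos_add]; ring

theorem norm_polarPoint_one (β : ℝ) : ‖polarPoint 1 β‖ = 1 := by
  rw [← pow_eq_one_iff_of_nonneg (norm_nonneg _) two_ne_zero, EuclideanSpace.norm_sq_eq]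
  simp [polarPoint]

theorem inner_polarPoint_add_pi_div_two (β : ℝ) :
    inner ℝ (polarPoint 1 β) (polarPoint 1 (β + Real.pi / 2)) = 0 := by
  simp [polarPoint, PiLp.inner_apply, Real.cos_add, Real.sin_add]
  ring

/-- The angle of a point of the plane with respect to an orthonormal frame. -/
noncomputable def planeAngle (e w x : Euc 2) : ℝ :=
  Complex.arg ⟨inner ℝ x e, inner ℝ x w⟩

theorem planeAngle_planePoint {e w : Euc 2} (he : ‖e‖ = 1) (hw : ‖w‖ = 1) (hew : inner ℝ e w = 0)
    {r : ℝ} (hr : 0 < r) {ψ : ℝ} (hψ : ψ ∈ Ioc (-Real.pi) Real.pi) :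
    planeAngle e w (planePoint 0 e w r ψ) = ψ := by
  have h1 : (⟨inner ℝ (planePoint 0 e w r ψ) e, inner ℝ (planePoint 0 e w r ψ) w⟩ : ℂ) =
      r * (Complex.cos ψ + Complex.sin ψ * Complex.I) := by
    rw [← Complex.ofReal_cos, ← Complex.ofReal_sin]
    apply Complex.ext <;>
      simp [planePoint, inner_add_left, inner_smul_left, he, hw, hew, real_inner_comm e w,
        -Complex.ofReal_cos, -Complex.ofReal_sin]
  rw [planeAngle, h1, Complex.arg_mul_cos_add_sin_mul_I hr hψ]

theorem planePoint_planeAngle {e w : Euc 2} (he : ‖e‖ = 1) (hw : ‖w‖ = 1) (hew : inner ℝ e w = 0)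
    (x : Euc 2) : planePoint 0 e w ‖x‖ (planeAngle e w x) = x := by
  have hdec := eq_smul_add_smul_of_dim_two he hw hew x
  have hn : ‖(⟨inner ℝ x e, inner ℝ x w⟩ : ℂ)‖ = ‖x‖ := by
    have h1 := norm_smul_add_smul he hw hew (inner ℝ x e) (inner ℝ x w)
    rw [← hdec] at h1
    rw [← sq_eq_sq₀ (norm_nonneg _) (norm_nonneg _), h1, Complex.sq_norm, Complex.normSq_mk]
    ring
  have hc := Complex.norm_mul_cos_arg (⟨inner ℝ x e, inner ℝ x w⟩ : ℂ)
  have hs := Complex.norm_mul_sin_arg (⟨inner ℝ x e, inner ℝ x w⟩ : ℂ)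
  rw [hn] at hc hs
  rw [planePoint, zero_add, smul_add, smul_smul, smul_smul, planeAngle, hc, hs]
  exact hdec.symm

theorem brtInjectiveWithSubdomains_polarDomain {α : ℝ} (hα : 0 < α) (hα2 : α ≤ 2 * Real.pi)
    {h : ℝ → ℝ} (hh : ContinuousOn h (Ioo 0 α)) (hbdd : BddAbove (h '' Ioo 0 α)) :
    BrtInjectiveWithSubdomains (polarDomain α h) (polarGraph α h) := by
  have hpi := Real.pi_pos
  let e := polarPoint 1 (α / 2)
  let w := polarPoint 1 (α / 2 + Real.pi / 2)
  have he : ‖e‖ = 1 := norm_polarPoint_one _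
  have hw : ‖w‖ = 1 := norm_polarPoint_one _
  have hew : inner ℝ e w = 0 := inner_polarPoint_add_pi_div_two _
  have he0 : e ≠ 0 := by intro h0; rw [h0, norm_zero] at he; exact zero_ne_one he
  have hC := isOpen_openCone (v := (0 : Euc 2)) he0 α
  have hpp : ∀ r θ, polarPoint r θ = planePoint 0 e w r (θ - α / 2) := by
    intro r θ
    rw [← polarPoint_add, sub_add_cancel]
  have hang : ∀ x ∈ openCone 0 e α, |planeAngle e w x| < α / 2 := by
    intro x hx
    refine (planePoint_mem_openCone_iff (v := 0) he hw hew (norm_pos_iff.2 hx.1)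
      (Complex.abs_arg_le_pi _)).1 ?_
    change planePoint 0 e w ‖x‖ (planeAngle e w x) ∈ _
    rwa [planePoint_planeAngle he hw hew]
  have hang' : ∀ x ∈ openCone 0 e α, planeAngle e w x + α / 2 ∈ Ioo 0 α := by
    intro x hx
    obtain ⟨h1, h2⟩ := abs_lt.1 (hang x hx)
    exact ⟨by linarith, by linarith⟩
  have hmem : ∀ r θ, 0 < r → 0 < θ → θ < α → polarPoint r θ ∈ openCone 0 e α ∧
      planeAngle e w (polarPoint r θ) + α / 2 = θ ∧ ‖polarPoint r θ‖ = r := by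
    intro r θ hr h1 h2
    have habs : |θ - α / 2| < α / 2 := abs_lt.2 ⟨by linarith, by linarith⟩
    rw [hpp]
    refine ⟨(planePoint_mem_openCone_iff he hw hew hr (by linarith)).2 habs, ?_, ?_⟩
    · rw [planeAngle_planePoint he hw hew hr ⟨by linarith, by linarith⟩]; ring
    · simpa using norm_planePoint_sub (v := 0) he hw hew hr.le (θ - α / 2)
  have hpolar : ∀ x, polarPoint ‖x‖ (planeAngle e w x + α / 2) = x := by
    intro x
    rw [hpp, add_sub_cancel_right, planePoint_planeAngle he hw hew]
  have hG : ContinuousOn (fun x => h (planeAngle e w x + α / 2)) (openCone 0 e α) := by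
    refine hh.comp (ContinuousOn.add ?_ continuousOn_const) hang'
    intro x hx
    -- Measured from the bisector, the angle stays strictly below `α / 2 ≤ π`, so the branch cut of
    -- the argument is avoided even for `α = 2π`.
    have h1 : (⟨inner ℝ x e, inner ℝ x w⟩ : ℂ) ∈ Complex.slitPlane := by
      rw [Complex.mem_slitPlane_iff_arg]
      refine ⟨fun h2 => ?_, fun h2 => ?_⟩
      · have h3 := hang x hx
        rw [planeAngle, h2, abs_of_pos hpi] at h3
        linarith
      · have h3 := eq_smul_add_smul_of_dim_two he hw hew x
        have h4 := congrArg Complex.re h2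
        have h5 := congrArg Complex.im h2
        simp only [Complex.zero_re, Complex.zero_im] at h4 h5
        rw [h4, h5, zero_smul, zero_smul, add_zero] at h3
        exact hx.1 h3
    have h2 : Continuous fun x : Euc 2 => (⟨inner ℝ x e, inner ℝ x w⟩ : ℂ) := by
      have h3 : Continuous fun x : Euc 2 =>
          ((inner ℝ x e : ℝ) : ℂ) + ((inner ℝ x w : ℝ) : ℂ) * Complex.I := by fun_prop
      refine h3.congr fun x => ?_
      exact (Complex.mk_eq_add_mul_I _ _).symm
    exact (ContinuousAt.comp (f := fun x : Euc 2 => (⟨inner ℝ x e, inner ℝ x w⟩ : ℂ))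
      (Complex.continuousAt_arg h1) h2.continuousAt).continuousWithinAt
  have hD : polarDomain α h =
      {x | x ∈ openCone 0 e α ∧ ‖x‖ < h (planeAngle e w x + α / 2)} := by
    ext x
    constructor
    · rintro ⟨r, θ, h1, h2, h3, h4, rfl⟩
      obtain ⟨h5, h6, h7⟩ := hmem r θ h3 h1 h2
      exact ⟨h5, by rw [h6, h7]; exact h4⟩
    · rintro ⟨h1, h2⟩
      exact ⟨‖x‖, planeAngle e w x + α / 2, (hang' x h1).1, (hang' x h1).2, norm_pos_iff.2 h1.1, h2,
        (hpolar x).symm⟩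
  have hE : {x | x ∈ openCone 0 e α ∧ ‖x‖ = h (planeAngle e w x + α / 2)} ⊆ polarGraph α h := by
    rintro x ⟨h1, h2⟩
    exact ⟨planeAngle e w x + α / 2, (hang' x h1).1, (hang' x h1).2, by rw [← h2, hpolar]⟩
  obtain ⟨M, hM⟩ := hbdd
  rw [hD]
  refine brtInjectiveWithSubdomains_of_subset_openCone (v := 0) le_rfl he0 hα hα2
    (isOpen_sep_norm_lt hC hG) ?_ (fun x hx => hx.1)
    ((sdiff_subset_sdiff_right hE).trans (frontier_sep_norm_lt_diff_subset hC hG))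
  refine (Metric.isBounded_closedBall (x := (0 : Euc 2)) (r := M)).subset fun x hx => ?_
  rw [mem_closedBall_zero_iff]
  exact hx.2.le.trans (hM ⟨_, hang' x hx.1, rfl⟩)

theorem IsConicalDomain.brtInjectiveWithSubdomains {n : ℕ} (hn : 2 ≤ n) {v u : Euc n} (hu : u ≠ 0)
    {α : ℝ} (hα : 0 < α) (hα2 : α ≤ 2 * Real.pi) {Ω E : Set (Euc n)}
    (h : IsConicalDomain v u α Ω E) : BrtInjectiveWithSubdomains Ω E :=
  brtInjectiveWithSubdomains_of_subset_openCone hn hu hα hα2 h.isOpen h.isBounded h.subset_cone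
    h.frontier_diff_subset

theorem pi_div_mem_Ioc {m : ℝ} (hm : 1 / 2 ≤ m) : 0 < Real.pi / m ∧ Real.pi / m ≤ 2 * Real.pi := by
  have hpi := Real.pi_pos
  have hm0 : 0 < m := by linarith
  refine ⟨by positivity, ?_⟩
  rw [div_le_iff₀ hm0]
  nlinarith

end BrokenRayTransform

theorem proposition2p2 :
    -- (1) planar cones of opening angle `π / m`, `m` a positive integer
    (∀ m : ℕ, 1 ≤ m →
      (∀ (v u : Euc 2) (Ω E : Set (Euc 2)), u ≠ 0 → IsConicalDomain v u (Real.pi / m) Ω E →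
        BrtInjectiveWithSubdomains Ω E) ∧
      (∀ h : ℝ → ℝ, ContinuousOn h (Set.Ioo 0 (Real.pi / m)) →
        (∀ θ ∈ Set.Ioo 0 (Real.pi / m), 0 < h θ) → BddAbove (h '' Set.Ioo 0 (Real.pi / m)) →
        BrtInjectiveWithSubdomains (polarDomain (Real.pi / m) h) (polarGraph (Real.pi / m) h))) ∧
    -- (2) planar cones of any opening angle `π / m` in `(0, 2π]`
    (∀ m : ℝ, 1 / 2 ≤ m →
      (∀ (v u : Euc 2) (Ω E : Set (Euc 2)), u ≠ 0 → IsConicalDomain v u (Real.pi / m) Ω E →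
        BrtInjectiveWithSubdomains Ω E) ∧
      (∀ h : ℝ → ℝ, ContinuousOn h (Set.Ioo 0 (Real.pi / m)) →
        (∀ θ ∈ Set.Ioo 0 (Real.pi / m), 0 < h θ) → BddAbove (h '' Set.Ioo 0 (Real.pi / m)) →
        BrtInjectiveWithSubdomains (polarDomain (Real.pi / m) h) (polarGraph (Real.pi / m) h))) ∧
    -- (3) cones `|x'| < k x` in dimension `d + 1 ≥ 2` with `π / (2 arctan k)` an integer
    (∀ d : ℕ, 1 ≤ d → ∀ k : ℝ, 0 < k → (∃ m : ℕ, Real.pi / (2 * Real.arctan k) = m) →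
      ∀ h : Euc (d + 1) → ℝ, ContinuousOn h (Metric.sphere 0 1) →
        (∀ ω ∈ Metric.sphere (0 : Euc (d + 1)) 1, 0 < h ω) →
        BrtInjectiveWithSubdomains
          (radialDomain (slopeCone d k) h) (radialGraph (slopeCone d k) h)) ∧
    -- (4) the same for all `k`, and for circular cones of any opening angle in `(0, 2π]`
    (∀ d : ℕ, 1 ≤ d → ∀ k : ℝ,
      ∀ h : Euc (d + 1) → ℝ, ContinuousOn h (Metric.sphere 0 1) →
        (∀ ω ∈ Metric.sphere (0 : Euc (d + 1)) 1, 0 < h ω) →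
        BrtInjectiveWithSubdomains
          (radialDomain (slopeCone d k) h) (radialGraph (slopeCone d k) h)) ∧
    (∀ n : ℕ, 2 ≤ n → ∀ α : ℝ, 0 < α → α ≤ 2 * Real.pi → ∀ u : Euc n, u ≠ 0 →
      (∀ h : Euc n → ℝ, ContinuousOn h (Metric.sphere 0 1) →
        (∀ ω ∈ Metric.sphere (0 : Euc n) 1, 0 < h ω) →
        BrtInjectiveWithSubdomains
          (radialDomain (openCone 0 u α) h) (radialGraph (openCone 0 u α) h)) ∧
      (∀ (v : Euc n) (Ω E : Set (Euc n)), IsConicalDomain v u α Ω E →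
        BrtInjectiveWithSubdomains Ω E)) := by
  refine ⟨fun m hm => ?_, fun m hm => ?_, ?_, ?_, ?_⟩
  · have hm' : (1 / 2 : ℝ) ≤ m := by
      have : (1 : ℝ) ≤ m := by exact_mod_cast hm
      linarith
    obtain ⟨hα, hα2⟩ := pi_div_mem_Ioc hm'
    exact ⟨fun v u Ω E hu h => h.brtInjectiveWithSubdomains le_rfl hu hα hα2,
      fun h hh _ hb => brtInjectiveWithSubdomains_polarDomain hα hα2 hh hb⟩
  · obtain ⟨hα, hα2⟩ := pi_div_mem_Ioc hm
    exact ⟨fun v u Ω E hu h => h.brtInjectiveWithSubdomains le_rfl hu hα hα2,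
      fun h hh _ hb => brtInjectiveWithSubdomains_polarDomain hα hα2 hh hb⟩
  · exact fun d hd k _ _ h hh _ => brtInjectiveWithSubdomains_slopeCone hd k hh
  · exact fun d hd k h hh _ => brtInjectiveWithSubdomains_slopeCone hd k hh
  · exact fun n hn α hα hα2 u hu =>
      ⟨fun h hh _ => brtInjectiveWithSubdomains_radialDomain hn hu hα hα2 hh,
        fun v Ω E h => h.brtInjectiveWithSubdomains hn hu hα hα2⟩
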